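/- Let $s>0$, $\mathbb H^2_s=\{(y,\sqrt{s^2+|y|^2}):y\in\mathbb R^2\}\subset\mathbb R^2\times\mathbb R$, with the measure $\sigma_s$ defined by $\int g\,d\sigma_s=\int_{\mathbb R^2}g(y,\sqrt{s^2+|y|^2})\,\frac{dy}{\sqrt{s^2+|y|^2}}$. For $f\in L^2(\mathbb H^2_s)=L^2(\sigma_s)$ let $T_sf=\widehat{f\sigma_s}$ be the Fourier transform on $\mathbb R^3$ (with $\hat g(\xi)=\int e^{-ix\cdot\xi}g(x)\,dx$, in the sense of tempered distributions) of $f\sigma_s$, and let $$\mathbf H_{2,4,s}=\sup_{0\neq f\in L^2(\mathbb H^2_s)}\frac{\|T_sf\|_{L^4(\mathbb R^3)}}{\|f\|_{L^2(\mathbb H^2_s)}}.$$ Let $\mathcal L^+$ be the group of invertible linear maps $L$ of $\mathbb R^2\times\mathbb R$ that preserve the bilinear form $((\xi,\tau),(\xi',\tau'))\mapsto\tau\tau'-\xi\cdot\xi'$ and map $\mathbb H^2_s$ onto itself, and write $L^*f=f\circ L$. Let $P=(0,s)$ be the vertex of $\mathbb H^2_s$. Let $\{f_n\}_{n\in\mathbb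 N}\subset L^2(\mathbb H^2_s)$ be an extremizing sequence, that is, $\|f_n\|_{L^2(\sigma_s)}\le 1$ for all $n$ and $\|T_sf_n\|_{L^4(\mathbb R^3)}\to\mathbf H_{2,4,s}$ as $n\to\infty$. Then there exists a sequence $\{L_n\}_{n\in\mathbb N}\subset\mathcal L^+$ such that for all $\varepsilon,r>0$ there exists $N\in\mathbb N$ such that for all $n\ge N$ $$\int_{|y-P|>r}|L_n^*f_n(y)|^2\,d\sigma_s(y)\le\varepsilon,$$ where $|\cdot|$ is the Euclidean norm on $\mathbb R^3$. -/

import Mathlib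

open MeasureTheory Filter Topology
open scoped ENNReal SchwartzMap

noncomputable section

namespace HyperboloidRestriction

/-- The space `ℝ^d × ℝ` with its Euclidean norm; a point is `z = (ξ, τ)` with `ξ = z.fst`,
`τ = z.snd`. -/
abbrev SpaceTime (d : ℕ) : Type := WithLp 2 (EuclideanSpace ℝ (Fin d) × ℝ)

/-- `ψ_s(y) = √(s² + |y|²)`. -/
def psi (d : ℕ) (s : ℝ) (y : EuclideanSpace ℝ (Fin d)) : ℝ := Real.sqrt (s ^ 2 + ‖y‖ ^ 2)

/-- The (upper sheet of the) hyperboloid `{(y, √(s² + |y|²)) : y ∈ ℝ^d}`. -/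
def hyperboloid (d : ℕ) (s : ℝ) : Set (SpaceTime d) := {z | z.snd = psi d s z.fst}

/-- The vertex `P = (0, s)`. -/
def vertex (d : ℕ) (s : ℝ) : SpaceTime d := WithLp.toLp 2 (0, s)

/-- The measure `σ_s = δ(τ - ψ_s(ξ)) dξ dτ / ψ_s(ξ)`: the image of `dy / ψ_s(y)` under the
parametrization `y ↦ (y, ψ_s(y))` of the hyperboloid. Functions on the hyperboloid are represented
by functions on `ℝ^d × ℝ` considered up to `σ_s`-null sets. -/
def sigma (d : ℕ) (s : ℝ) : Measure (SpaceTime d) :=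
  ((volume : Measure (EuclideanSpace ℝ (Fin d))).withDensity
    (fun y => ENNReal.ofReal (1 / psi d s y))).map (fun y => WithLp.toLp 2 (y, psi d s y))

/-- The Fourier transform `φ̂(ζ) = ∫ e^{-i z·ζ} φ(z) dz` on `ℝ^d × ℝ` (without `2π` in the
exponent). -/
def fourierHat (d : ℕ) (φ : SpaceTime d → ℂ) (ζ : SpaceTime d) : ℂ :=
  ∫ z, Complex.exp (-(Complex.I * (inner ℝ z ζ : ℝ))) * φ z

/-- The function `g` is `T_s f`, the Fourier transform of `f σ_s`. As `f ∈ L²(σ_s)` need not be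
`σ_s`-integrable, this is the Fourier transform of tempered distributions:
`⟨(f σ_s)^, φ⟩ = ⟨f σ_s, φ̂⟩` for all Schwartz functions `φ`. -/
def IsExtension (d : ℕ) (s : ℝ) (f g : SpaceTime d → ℂ) : Prop :=
  ∀ φ : 𝓢(SpaceTime d, ℂ), ∫ z, g z * φ z = ∫ ζ, f ζ * fourierHat d φ ζ ∂(sigma d s)

/-- The norm `‖T_s f‖_{L^p(ℝ^{d+1})}`: the `L^p` norm of the (almost everywhere unique) function
in `L^p` that represents `T_s f`, and `∞` if there is none. -/
def extensionNorm (d : ℕ) (s : ℝ) (p : ℝ≥0∞) (f : SpaceTime d → ℂ) : ℝ≥0∞ :=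
  ⨅ (g : SpaceTime d → ℂ) (_ : MemLp g p volume) (_ : IsExtension d s f g), eLpNorm g p volume

/-- The best constant `H_{d,p,s}`, the supremum of `‖T_s f‖_{L^p} / ‖f‖_{L²(σ_s)}` over
`0 ≠ f ∈ L²(σ_s)`. -/
def bestConstant (d : ℕ) (s : ℝ) (p : ℝ≥0∞) : ℝ≥0∞ :=
  ⨆ (f : SpaceTime d → ℂ) (_ : MemLp f 2 (sigma d s)) (_ : eLpNorm f 2 (sigma d s) ≠ 0),
    extensionNorm d s p f / eLpNorm f 2 (sigma d s)

/-- Extremizing sequences for `‖T_s f‖_{L^p} ≤ H_{d,p,s} ‖f‖_{L²(σ_s)}`. -/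
structure IsExtremizingSequence (d : ℕ) (s : ℝ) (p : ℝ≥0∞) (f : ℕ → SpaceTime d → ℂ) :
    Prop where
  memLp : ∀ n, MemLp (f n) 2 (sigma d s)
  norm_le_one : ∀ n, eLpNorm (f n) 2 (sigma d s) ≤ 1
  tendsto : Tendsto (fun n => extensionNorm d s p (f n)) atTop (𝓝 (bestConstant d s p))

/-- The Lorentz form `(x, y) ↦ x · J y` with `J = diag(-1, …, -1, 1)`. -/
def lorentzForm (d : ℕ) (x y : SpaceTime d) : ℝ := -inner ℝ x.fst y.fst + x.snd * y.snd

/-- The Lorentz group: the invertible linear maps of `ℝ^{d+1}` that preserve the Lorentz form. -/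
def lorentzGroup (d : ℕ) : Subgroup (SpaceTime d ≃ₗ[ℝ] SpaceTime d) where
  carrier := {L | ∀ x y, lorentzForm d (L x) (L y) = lorentzForm d x y}
  mul_mem' := fun {A B} hA hB x y => by
    simpa only [LinearEquiv.mul_apply] using (hA (B x) (B y)).trans (hB x y)
  one_mem' := fun x y => rfl
  inv_mem' := fun {A} hA x y => by
    have h := hA (A⁻¹ x) (A⁻¹ y)
    have e : ∀ v, A (A⁻¹ v) = v := fun v => A.apply_symm_apply v
    rw [e, e] at h
    exact h.symm

/-- The group `𝓛⁺` of the Lorentz transformations that map the hyperboloid onto itself. -/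
def lorentzGroupPlus (d : ℕ) (s : ℝ) : Subgroup (SpaceTime d ≃ₗ[ℝ] SpaceTime d) where
  carrier := {L | L ∈ lorentzGroup d ∧ ∀ z, L z ∈ hyperboloid d s ↔ z ∈ hyperboloid d s}
  mul_mem' := fun {A B} hA hB =>
    ⟨(lorentzGroup d).mul_mem hA.1 hB.1, fun z => (hA.2 (B z)).trans (hB.2 z)⟩
  one_mem' := ⟨(lorentzGroup d).one_mem, fun _ => Iff.rfl⟩
  inv_mem' := fun {A} hA => ⟨(lorentzGroup d).inv_mem hA.1, fun z => by
    have h := hA.2 (A⁻¹ z)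
    have e : A (A⁻¹ z) = z := A.apply_symm_apply z
    rw [e] at h
    exact h.symm⟩

/-- `L^* f = f ∘ L`. -/
def pullback (d : ℕ) (L : SpaceTime d ≃ₗ[ℝ] SpaceTime d) (f : SpaceTime d → ℂ) :
    SpaceTime d → ℂ := fun z => f (L z)

end HyperboloidRestriction

end

/-! Since 4 is an even exponent, the square of $\widehat{f\sigma_s}$ is the Fourier transform of the
convolution $f\sigma_s*f\sigma_s$, and Plancherel turns $\|T_sf\|_4^4$ into a multiple of
$\|f\sigma_s*f\sigma_s\|_2^2$. Cauchy–Schwarz on each fibre $\{x+y=X\}$ bounds this by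
$C\iint|f(x)|^2|f(y)|^2K(x,y)$ with $K(x,y)=((x+y)\cdot J(x+y))^{-1/2}$, because in two space
dimensions $\sigma_s*\sigma_s$ is a multiple of $(X\cdot JX)^{-1/2}$ on its support
(`lintegral_fiberMap`, `exists_lintegral_extFn_pow_four`). There $X\cdot JX\ge4s^2$, so
$K\le\kappa=1/(2s)$ and $\mathbf H^4\le C\kappa$.

The bound is sharp. For $e^{-a\tau}$ the product $f(x)f(y)$ depends only on $x+y$, so Cauchy–Schwarz
is an equality, and as $a\to\infty$ these functions concentrate at the vertex, where $K$ tends to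
$\kappa$ (`mul_le_bestConstant_pow_four`).

Hence the double integral $E_n$ of an extremizing sequence is eventually above every number less
than $\kappa$. The averaged defect $\iint|f_n(x)|^2|f_n(y)|^2(\kappa-K(x,y))$ is at most
$\kappa-E_n$, so some centre $x_n$ has a small defect $\int(\kappa-K(x_n,y))|f_n(y)|^2$
(`exists_center`). A Lorentz map takes the vertex $P$ to $x_n$ and preserves both $K$ and
$\sigma_s$, and $\kappa-K(P,\cdot)$ is bounded below away from $P$ (`exists_pairKernel_gap`).
Chebyshev's inequality then bounds the mass away from $P$.

All computations use the parameters $(t,v)$ with $\tau+\xi_1=e^t$ and $\xi_2=v$, in which $\sigma_s$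
is $dt\,dv$. -/

namespace HyperboloidRestriction

/-! ### One-variable substitutions -/

/-- The substitution `y = m sinh b`. -/
theorem lintegral_comp_mul_sinh {m : ℝ} (hm : 0 < m) (h : ℝ → ℝ≥0∞) :
    ∫⁻ b, h (m * Real.sinh b) = ∫⁻ y, ENNReal.ofReal (1 / √(m ^ 2 + y ^ 2)) * h y := by
  have himg : (fun b => m * Real.sinh b) '' Set.univ = Set.univ := by
    rw [Set.image_univ, Set.range_eq_univ]
    intro y
    exact ⟨Real.arsinh (y / m), by simp only [Real.sinh_arsinh]; field_simp⟩
  have hinj : Set.InjOn (fun b => m * Real.sinh b) Set.univ := by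
    intro a _ b _ hab
    exact Real.sinh_injective (mul_left_cancel₀ hm.ne' hab)
  have key := lintegral_image_eq_lintegral_abs_deriv_mul MeasurableSet.univ
    (fun b _ => ((Real.hasDerivAt_sinh b).const_mul m).hasDerivWithinAt) hinj
    (fun y => ENNReal.ofReal (1 / √(m ^ 2 + y ^ 2)) * h y)
  rw [himg, setLIntegral_univ, setLIntegral_univ] at key
  rw [key]
  refine lintegral_congr fun b => ?_
  have hc := Real.cosh_pos b
  have hsq : √(m ^ 2 + (m * Real.sinh b) ^ 2) = m * Real.cosh b := by
    rw [show m ^ 2 + (m * Real.sinh b) ^ 2 = (m * Real.cosh b) ^ 2 by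
      rw [mul_pow, mul_pow, Real.cosh_sq]; ring]
    exact Real.sqrt_sq (by positivity)
  rw [hsq, ← mul_assoc, ← ENNReal.ofReal_mul (abs_nonneg _), abs_of_pos (by positivity),
    mul_one_div_cancel (by positivity), ENNReal.ofReal_one, one_mul]

/-- The substitution `y = (e^t - m² e^{-t}) / 2`. -/
theorem lintegral_comp_exp_sub {m : ℝ} (hm : 0 < m) (h : ℝ → ℝ≥0∞) :
    ∫⁻ t, h ((Real.exp t - m ^ 2 * Real.exp (-t)) / 2) =
      ∫⁻ y, ENNReal.ofReal (1 / √(m ^ 2 + y ^ 2)) * h y := by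
  rw [← lintegral_comp_mul_sinh hm, ← lintegral_add_right_eq_self _ (Real.log m)]
  refine lintegral_congr fun b => ?_
  congr 1
  rw [Real.sinh_eq, neg_add, Real.exp_add, Real.exp_add, Real.exp_neg (Real.log m),
    Real.exp_log hm]
  field_simp

/-- The substitution `y = m sinh (a / 2)`. -/
theorem lintegral_comp_mul_sinh_half {m : ℝ} (hm : 0 < m) (h : ℝ → ℝ≥0∞) :
    ∫⁻ a, h (m * Real.sinh (a / 2)) = ∫⁻ y, ENNReal.ofReal (2 / √(m ^ 2 + y ^ 2)) * h y := by
  have himg : (fun b : ℝ => 2 * b) '' Set.univ = Set.univ := by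
    rw [Set.image_univ, Set.range_eq_univ]
    intro y
    exact ⟨y / 2, by ring⟩
  have key := lintegral_image_eq_lintegral_abs_deriv_mul MeasurableSet.univ
    (fun b _ => ((hasDerivAt_id b).const_mul (2 : ℝ)).hasDerivWithinAt)
    (fun a _ b _ hab => mul_left_cancel₀ two_ne_zero hab)
    (fun a => h (m * Real.sinh (a / 2)))
  simp only [id] at key
  rw [himg, setLIntegral_univ, setLIntegral_univ] at key
  rw [key, lintegral_const_mul' _ _ (by simp)]
  simp only [mul_div_cancel_left₀ _ (two_ne_zero (α := ℝ))]
  rw [lintegral_comp_mul_sinh hm, ← lintegral_const_mul' _ _ (by simp)]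
  refine lintegral_congr fun y => ?_
  rw [← mul_assoc, ← ENNReal.ofReal_mul (abs_nonneg _)]
  congr 2
  norm_num
  ring

/-- The substitution `T = log U`. -/
theorem lintegral_comp_log (h : ℝ → ℝ≥0∞) :
    ∫⁻ T, h T = ∫⁻ U in Set.Ioi 0, ENNReal.ofReal (1 / U) * h (Real.log U) := by
  have himg : Real.exp '' Set.univ = Set.Ioi 0 := by rw [Set.image_univ, Real.range_exp]
  have key := lintegral_image_eq_lintegral_abs_deriv_mul MeasurableSet.univ
    (fun b _ => (Real.hasDerivAt_exp b).hasDerivWithinAt) Real.exp_injective.injOn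
    (fun U => ENNReal.ofReal (1 / U) * h (Real.log U))
  rw [himg, setLIntegral_univ] at key
  rw [key]
  refine lintegral_congr fun b => ?_
  have := Real.exp_pos b
  rw [← mul_assoc, ← ENNReal.ofReal_mul (abs_nonneg _), abs_of_pos this, Real.log_exp,
    mul_one_div_cancel this.ne', ENNReal.ofReal_one, one_mul]

/-- The substitution `N = 4 (s² + ρ²)`. -/
theorem lintegral_Ioi_comp_radius (s : ℝ) (h : ℝ → ℝ≥0∞) :
    ∫⁻ ρ in Set.Ioi 0, ENNReal.ofReal (ρ * (2 / √(s ^ 2 + ρ ^ 2))) * h ρ =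
      ∫⁻ N in Set.Ioi (4 * s ^ 2), ENNReal.ofReal (1 / (2 * √N)) * h (√(N / 4 - s ^ 2)) := by
  have himg : (fun ρ : ℝ => 4 * (s ^ 2 + ρ ^ 2)) '' Set.Ioi 0 = Set.Ioi (4 * s ^ 2) := by
    ext N
    constructor
    · rintro ⟨ρ, hρ, rfl⟩
      have : 0 < ρ ^ 2 := pow_pos hρ 2
      simp only [Set.mem_Ioi]
      linarith
    · intro hN
      have hN' : 0 < N / 4 - s ^ 2 := by simp only [Set.mem_Ioi] at hN; linarith
      refine ⟨√(N / 4 - s ^ 2), Real.sqrt_pos.2 hN', ?_⟩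
      simp only [Real.sq_sqrt hN'.le]
      ring
  have hinj : Set.InjOn (fun ρ : ℝ => 4 * (s ^ 2 + ρ ^ 2)) (Set.Ioi 0) := by
    intro a ha b hb hab
    have h2 : a ^ 2 = b ^ 2 := by simp only at hab; linarith
    exact (pow_left_inj₀ (le_of_lt ha) (le_of_lt hb) two_ne_zero).1 h2
  have hder : ∀ ρ ∈ Set.Ioi (0 : ℝ), HasDerivWithinAt (fun ρ : ℝ => 4 * (s ^ 2 + ρ ^ 2))
      (4 * (2 * ρ)) (Set.Ioi 0) ρ := fun ρ _ => by
    simpa using ((((hasDerivAt_id ρ).pow 2).const_add (s ^ 2)).const_mul 4).hasDerivWithinAt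
  rw [← himg, lintegral_image_eq_lintegral_abs_deriv_mul measurableSet_Ioi hder hinj]
  refine setLIntegral_congr_fun measurableSet_Ioi fun ρ hρ => ?_
  have hρ' : (0 : ℝ) < ρ := hρ
  have hp : 0 < s ^ 2 + ρ ^ 2 := by positivity
  have h4 : √(4 * (s ^ 2 + ρ ^ 2)) = 2 * √(s ^ 2 + ρ ^ 2) := by
    rw [Real.sqrt_mul (by norm_num), show (4 : ℝ) = 2 ^ 2 by norm_num, Real.sqrt_sq two_pos.le]
  rw [← mul_assoc, ← ENNReal.ofReal_mul (abs_nonneg _), h4,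
    show 4 * (s ^ 2 + ρ ^ 2) / 4 - s ^ 2 = ρ ^ 2 by ring, Real.sqrt_sq hρ'.le,
    abs_of_pos (by positivity)]
  congr 2
  have := Real.sqrt_pos.2 hp
  field_simp
  ring

/-- The substitution `N = U W - b`. -/
theorem lintegral_comp_mul_sub {U : ℝ} (hU : 0 < U) (b : ℝ) (h : ℝ → ℝ≥0∞) :
    ENNReal.ofReal (1 / U) * ∫⁻ N, h N = ∫⁻ W, h (U * W - b) := by
  have himg : (fun W : ℝ => U * W - b) '' Set.univ = Set.univ := by
    rw [Set.image_univ, Set.range_eq_univ]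
    intro y
    exact ⟨(y + b) / U, by field_simp; ring⟩
  have key := lintegral_image_eq_lintegral_abs_deriv_mul MeasurableSet.univ
    (fun W _ => (((hasDerivAt_id W).const_mul U).sub_const b).hasDerivWithinAt)
    (fun x _ y _ hab => mul_left_cancel₀ hU.ne' (sub_left_injective hab)) h
  simp only [id] at key
  rw [himg, setLIntegral_univ, setLIntegral_univ] at key
  rw [key, lintegral_const_mul' _ _ (by simp), ← mul_assoc, ← ENNReal.ofReal_mul (by positivity),
    mul_one, abs_of_pos hU, one_div_mul_cancel hU.ne', ENNReal.ofReal_one, one_mul]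

/-! ### Total and relative momentum of a pair of points -/

/-- `log (1 + e^a) - a = log (1 + e^{-a})`. -/
theorem log_one_add_exp_sub (a : ℝ) :
    Real.log (1 + Real.exp a) - a = Real.log (1 + Real.exp (-a)) := by
  have h : 1 + Real.exp a = (1 + Real.exp (-a)) * Real.exp a := by
    rw [add_mul, ← Real.exp_add]; simp [add_comm]
  rw [h, Real.log_mul (by positivity) (Real.exp_pos a).ne', Real.log_exp]
  ring

/-- Here $e^T=e^t+e^{t'}$ and $a=t-t'$. For fixed $a$ this is a translation in $T$, so the Jacobian
is 1. -/
theorem lintegral_lintegral_shear_log (F : ℝ → ℝ → ℝ≥0∞) (hF : Measurable (Function.uncurry F)) :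
    ∫⁻ t, ∫⁻ t', F t t' = ∫⁻ a, ∫⁻ T, F (T - Real.log (1 + Real.exp (-a)))
      (T - Real.log (1 + Real.exp a)) := by
  rw [lintegral_lintegral_swap hF.aemeasurable]
  have h1 : ∀ t', ∫⁻ t, F t t' = ∫⁻ a, F (a + t') t' := fun t' =>
    (lintegral_add_right_eq_self (fun t => F t t') t').symm
  simp_rw [h1]
  rw [lintegral_lintegral_swap]
  · refine lintegral_congr fun a => ?_
    rw [← lintegral_sub_right_eq_self _ (Real.log (1 + Real.exp a))]
    refine lintegral_congr fun T => ?_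
    rw [← log_one_add_exp_sub]
    congr 1
    ring
  · exact (hF.comp (by fun_prop : Measurable fun p : ℝ × ℝ => (p.2 + p.1, p.1))).aemeasurable

/-- The total is $V=v+v'$, and $q$ measures how far $v$ is from the share $\theta V$. The map is
unimodular for every $\theta$, which may therefore depend on the other variables. -/
theorem lintegral_lintegral_shear (θ : ℝ) (F : ℝ → ℝ → ℝ≥0∞)
    (hF : Measurable (Function.uncurry F)) :
    ∫⁻ v, ∫⁻ v', F v v' = ∫⁻ V, ∫⁻ q, F (V * θ + q) (V * (1 - θ) - q) := by
  have h1 : ∀ v, ∫⁻ v', F v v' = ∫⁻ V, F v (V - v) := fun v =>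
    (lintegral_sub_right_eq_self (fun v' => F v v') v).symm
  simp_rw [h1]
  rw [lintegral_lintegral_swap]
  · refine lintegral_congr fun V => ?_
    rw [← lintegral_add_left_eq_self _ (V * θ)]
    refine lintegral_congr fun q => ?_
    congr 1
    ring
  · exact (hF.comp (by fun_prop : Measurable fun p : ℝ × ℝ => (p.1, p.2 - p.1))).aemeasurable

/-- The pair of points of the half plane with total logarithmic momentum `T`, total transversal
momentum `V`, relative rapidity `a` and relative transversal momentum `q`. -/
noncomputable def relativePair (T V a q : ℝ) : (ℝ × ℝ) × (ℝ × ℝ) :=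
  ((T - Real.log (1 + Real.exp (-a)), V * (1 / (1 + Real.exp (-a))) + q),
    (T - Real.log (1 + Real.exp a), V * (1 - 1 / (1 + Real.exp (-a))) - q))

theorem measurable_relativePair :
    Measurable fun x : ℝ × ℝ × ℝ × ℝ => relativePair x.1 x.2.1 x.2.2.1 x.2.2.2 := by
  unfold relativePair
  fun_prop

/-- The share is $\theta=e^t/(e^t+e^{t'})=1/(1+e^{-a})$. With it the Lorentz square of the sum
depends on $a$ and $q$ only, which is what makes the fibres explicit. -/
theorem lintegral_relativePair {F : (ℝ × ℝ) × (ℝ × ℝ) → ℝ≥0∞} (hF : Measurable F) :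
    ∫⁻ p, F p = ∫⁻ T, ∫⁻ V, ∫⁻ a, ∫⁻ q, F (relativePair T V a q) := by
  have hR : Measurable fun x : ℝ × ℝ × ℝ × ℝ => F (relativePair x.1 x.2.1 x.2.2.1 x.2.2.2) :=
    hF.comp measurable_relativePair
  calc ∫⁻ p, F p = ∫⁻ t, ∫⁻ v, ∫⁻ t', ∫⁻ v', F ((t, v), (t', v')) := by
        rw [Measure.volume_eq_prod, lintegral_prod _ hF.aemeasurable, Measure.volume_eq_prod,
          lintegral_prod]
        · refine lintegral_congr fun t => lintegral_congr fun v => ?_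
          rw [lintegral_prod]
          exact (hF.comp (by fun_prop)).aemeasurable
        · exact (hF.lintegral_prod_right').aemeasurable
    _ = ∫⁻ t, ∫⁻ t', ∫⁻ v, ∫⁻ v', F ((t, v), (t', v')) := by
        refine lintegral_congr fun t => ?_
        rw [lintegral_lintegral_swap]
        refine Measurable.aemeasurable ?_
        exact Measurable.lintegral_prod_right'
          (f := fun x : (ℝ × ℝ) × ℝ => F ((t, x.1.1), (x.1.2, x.2))) (hF.comp (by fun_prop))
    _ = ∫⁻ a, ∫⁻ T, ∫⁻ v, ∫⁻ v', F ((T - Real.log (1 + Real.exp (-a)), v),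
          (T - Real.log (1 + Real.exp a), v')) := by
        refine lintegral_lintegral_shear_log
          (fun t t' => ∫⁻ v, ∫⁻ v', F ((t, v), (t', v'))) ?_
        refine Measurable.lintegral_prod_right'
          (f := fun x : (ℝ × ℝ) × ℝ => ∫⁻ v', F ((x.1.1, x.2), (x.1.2, v'))) ?_
        exact Measurable.lintegral_prod_right'
          (f := fun x : ((ℝ × ℝ) × ℝ) × ℝ => F ((x.1.1.1, x.1.2), (x.1.1.2, x.2)))
          (hF.comp (by fun_prop))
    _ = ∫⁻ a, ∫⁻ T, ∫⁻ V, ∫⁻ q, F (relativePair T V a q) := by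
        refine lintegral_congr fun a => lintegral_congr fun T => ?_
        exact lintegral_lintegral_shear (1 / (1 + Real.exp (-a)))
          (fun v v' => F ((T - Real.log (1 + Real.exp (-a)), v),
            (T - Real.log (1 + Real.exp a), v'))) (hF.comp (by fun_prop))
    _ = ∫⁻ T, ∫⁻ a, ∫⁻ V, ∫⁻ q, F (relativePair T V a q) := by
        rw [lintegral_lintegral_swap]
        refine Measurable.aemeasurable ?_
        refine Measurable.lintegral_prod_right'
          (f := fun x : (ℝ × ℝ) × ℝ => ∫⁻ q, F (relativePair x.1.2 x.2 x.1.1 q)) ?_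
        exact Measurable.lintegral_prod_right'
          (f := fun x : ((ℝ × ℝ) × ℝ) × ℝ => F (relativePair x.1.1.2 x.1.2 x.1.1.1 x.2))
          (hR.comp (by fun_prop : Measurable fun x : ((ℝ × ℝ) × ℝ) × ℝ =>
            (x.1.1.2, x.1.2, x.1.1.1, x.2)))
    _ = _ := by
        refine lintegral_congr fun T => ?_
        rw [lintegral_lintegral_swap]
        refine Measurable.aemeasurable ?_
        exact Measurable.lintegral_prod_right'
          (f := fun x : (ℝ × ℝ) × ℝ => F (relativePair T x.1.2 x.1.1 x.2))
          (hR.comp (by fun_prop : Measurable fun x : (ℝ × ℝ) × ℝ => (T, x.1.2, x.1.1, x.2)))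

/-! ### Polar coordinates and disintegration over the sum -/

/-- The relative rapidity as a function of polar coordinates in the centre of mass frame. -/
noncomputable def polarRapidity (s ρ α : ℝ) : ℝ :=
  2 * Real.arsinh (ρ * Real.cos α / √(s ^ 2 + (ρ * Real.sin α) ^ 2))

theorem measurable_arsinh_comp {β : Type*} [MeasurableSpace β] {f : β → ℝ} (hf : Measurable f) :
    Measurable fun x => Real.arsinh (f x) :=
  Real.continuous_arsinh.measurable.comp hf

theorem measurable_polarRapidity (s : ℝ) :
    Measurable fun x : ℝ × ℝ => polarRapidity s x.1 x.2 := by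
  unfold polarRapidity
  exact (measurable_arsinh_comp (by fun_prop)).const_mul 2

/-- Put $A=\sqrt{s^2+q^2}\sinh(a/2)$ and $(A,q)=\rho(\cos\alpha,\sin\alpha)$. The density
$2/\sqrt{s^2+q^2+A^2}$ of $da\,dq$ is radial, and with $N=4(s^2+\rho^2)$ the measure becomes
$dN\,d\alpha/(2\sqrt N)$. This $N$ is the Lorentz square of the sum. -/
theorem lintegral_polarRapidity {s : ℝ} (hs : 0 < s) {H : ℝ → ℝ → ℝ≥0∞}
    (hH : Measurable (Function.uncurry H)) :
    ∫⁻ a, ∫⁻ q, H a q = ∫⁻ N in Set.Ici (4 * s ^ 2), ENNReal.ofReal (1 / (2 * √N)) *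
      ∫⁻ α in Set.Ioo (-Real.pi) Real.pi,
        H (polarRapidity s (√(N / 4 - s ^ 2)) α) (√(N / 4 - s ^ 2) * Real.sin α) := by
  have hsub : Measurable fun p : ℝ × ℝ =>
      (2 * Real.arsinh (p.1 / √(s ^ 2 + p.2 ^ 2)), p.2) :=
    ((measurable_arsinh_comp (by fun_prop)).const_mul 2).prodMk measurable_snd
  have hJ : Measurable fun p : ℝ × ℝ => ENNReal.ofReal (2 / √(s ^ 2 + p.2 ^ 2 + p.1 ^ 2)) *
      H (2 * Real.arsinh (p.1 / √(s ^ 2 + p.2 ^ 2))) p.2 :=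
    Measurable.mul (by fun_prop) (hH.comp hsub)
  calc ∫⁻ a, ∫⁻ q, H a q = ∫⁻ q, ∫⁻ a, H a q := lintegral_lintegral_swap hH.aemeasurable
    _ = ∫⁻ q, ∫⁻ A, ENNReal.ofReal (2 / √(s ^ 2 + q ^ 2 + A ^ 2)) *
          H (2 * Real.arsinh (A / √(s ^ 2 + q ^ 2))) q := by
        refine lintegral_congr fun q => ?_
        have hm : 0 < √(s ^ 2 + q ^ 2) := Real.sqrt_pos.2 (by positivity)
        have := lintegral_comp_mul_sinh_half hm
          (fun A => H (2 * Real.arsinh (A / √(s ^ 2 + q ^ 2))) q)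
        rw [Real.sq_sqrt (by positivity)] at this
        rw [← this]
        refine lintegral_congr fun a => ?_
        rw [mul_div_cancel_left₀ _ hm.ne', Real.arsinh_sinh]
        congr 1
        ring
    _ = ∫⁻ A, ∫⁻ q, ENNReal.ofReal (2 / √(s ^ 2 + q ^ 2 + A ^ 2)) *
          H (2 * Real.arsinh (A / √(s ^ 2 + q ^ 2))) q := by
        rw [lintegral_lintegral_swap]
        exact (hJ.comp measurable_swap).aemeasurable
    _ = ∫⁻ p : ℝ × ℝ, ENNReal.ofReal (2 / √(s ^ 2 + p.2 ^ 2 + p.1 ^ 2)) *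
          H (2 * Real.arsinh (p.1 / √(s ^ 2 + p.2 ^ 2))) p.2 := by
        rw [Measure.volume_eq_prod, lintegral_prod _ hJ.aemeasurable]
    _ = ∫⁻ p : ℝ × ℝ in Set.Ioi 0 ×ˢ Set.Ioo (-Real.pi) Real.pi,
          ENNReal.ofReal (p.1 * (2 / √(s ^ 2 + p.1 ^ 2))) *
            H (polarRapidity s p.1 p.2) (p.1 * Real.sin p.2) := by
        rw [← lintegral_comp_polarCoord_symm, polarCoord_target]
        refine setLIntegral_congr_fun (measurableSet_Ioi.prod measurableSet_Ioo) fun p hp => ?_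
        have hp1 : 0 < p.1 := hp.1
        simp only [polarCoord_symm_apply, smul_eq_mul, polarRapidity]
        rw [← mul_assoc, ← ENNReal.ofReal_mul hp1.le]
        congr 5
        have := Real.sin_sq_add_cos_sq p.2
        calc _ = s ^ 2 + p.1 ^ 2 * (Real.sin p.2 ^ 2 + Real.cos p.2 ^ 2) := by ring
          _ = _ := by rw [this, mul_one]
    _ = ∫⁻ ρ in Set.Ioi 0, ENNReal.ofReal (ρ * (2 / √(s ^ 2 + ρ ^ 2))) *
          ∫⁻ α in Set.Ioo (-Real.pi) Real.pi, H (polarRapidity s ρ α) (ρ * Real.sin α) := by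
        rw [Measure.volume_eq_prod, ← Measure.prod_restrict, lintegral_prod]
        · refine lintegral_congr fun ρ => ?_
          simp only
          rw [lintegral_const_mul' _ _ ENNReal.ofReal_ne_top]
        · have hp : Measurable fun p : ℝ × ℝ => (polarRapidity s p.1 p.2, p.1 * Real.sin p.2) :=
            (measurable_polarRapidity s).prodMk (by fun_prop)
          exact (Measurable.mul (by fun_prop) (hH.comp hp)).aemeasurable
    _ = _ := by rw [setLIntegral_congr Ioi_ae_eq_Ici.symm, lintegral_Ioi_comp_radius]

/-- The Lorentz square of a vector with light-cone coordinates `U`, `V`, `W`. -/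
noncomputable def coneSq (X : ℝ × ℝ × ℝ) : ℝ := X.1 * X.2.2 - X.2.1 ^ 2

/-- The parametrization of the pairs of points of the hyperboloid with given sum. -/
noncomputable def fiberMap (s : ℝ) (X : ℝ × ℝ × ℝ) (α : ℝ) : (ℝ × ℝ) × (ℝ × ℝ) :=
  relativePair (Real.log X.1) X.2.1 (polarRapidity s (√(coneSq X / 4 - s ^ 2)) α)
    (√(coneSq X / 4 - s ^ 2) * Real.sin α)

/-- The region of the sums of two points of the hyperboloid. -/
noncomputable def sumRegion (s : ℝ) : Set (ℝ × ℝ × ℝ) := {X | 0 < X.1 ∧ 4 * s ^ 2 ≤ coneSq X}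

/-- The density of the measures on the fibres of the addition. -/
noncomputable def fiberWeight (s : ℝ) : ℝ × ℝ × ℝ → ℝ≥0∞ :=
  (sumRegion s).indicator fun X => ENNReal.ofReal (1 / (2 * √(coneSq X)))

theorem measurable_coneSq : Measurable coneSq := by
  unfold coneSq
  fun_prop

theorem measurableSet_sumRegion (s : ℝ) : MeasurableSet (sumRegion s) :=
  (measurableSet_lt measurable_const measurable_fst).inter
    (measurableSet_le measurable_const measurable_coneSq)

theorem measurable_fiberWeight (s : ℝ) : Measurable (fiberWeight s) := by
  refine Measurable.indicator ?_ (measurableSet_sumRegion s)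
  have := measurable_coneSq
  fun_prop

theorem measurable_fiberMap (s : ℝ) :
    Measurable fun x : (ℝ × ℝ × ℝ) × ℝ => fiberMap s x.1 x.2 := by
  have hc := measurable_coneSq
  have h1 : Measurable fun x : (ℝ × ℝ × ℝ) × ℝ => (√(coneSq x.1 / 4 - s ^ 2), x.2) := by fun_prop
  have h2 := (measurable_polarRapidity s).comp h1
  have h3 : Measurable fun x : (ℝ × ℝ × ℝ) × ℝ => (Real.log x.1.1, x.1.2.1,
      polarRapidity s (√(coneSq x.1 / 4 - s ^ 2)) x.2,
        √(coneSq x.1 / 4 - s ^ 2) * Real.sin x.2) := by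
    refine Measurable.prodMk (by fun_prop) (Measurable.prodMk (by fun_prop)
      (Measurable.prodMk h2 (by fun_prop)))
  exact measurable_relativePair.comp h3

/-- From $T=\log U$ and $N=UW-V^2$ one gets $dT\,dN=dU\,dW$ for fixed $V$. The fibres are circles
carrying $d\alpha$, and the weight $1/(2\sqrt N)$ depends on the sum alone; this is the explicit
formula for $\sigma_s*\sigma_s$. -/
theorem lintegral_fiberMap {s : ℝ} (hs : 0 < s) {F : (ℝ × ℝ) × (ℝ × ℝ) → ℝ≥0∞}
    (hF : Measurable F) :
    ∫⁻ p, F p = ∫⁻ X, fiberWeight s X * ∫⁻ α in Set.Ioo (-Real.pi) Real.pi,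
      F (fiberMap s X α) := by
  have hR : Measurable fun x : ℝ × ℝ × ℝ × ℝ => F (relativePair x.1 x.2.1 x.2.2.1 x.2.2.2) :=
    hF.comp measurable_relativePair
  have hG : Measurable fun x : (ℝ × ℝ × ℝ) × ℝ => F (fiberMap s x.1 x.2) :=
    hF.comp (measurable_fiberMap s)
  set J : ℝ → ℝ → ℝ → ℝ≥0∞ := fun T V N => (Set.Ici (4 * s ^ 2)).indicator (fun N =>
    ENNReal.ofReal (1 / (2 * √N)) * ∫⁻ α in Set.Ioo (-Real.pi) Real.pi,
      F (relativePair T V (polarRapidity s (√(N / 4 - s ^ 2)) α)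
        (√(N / 4 - s ^ 2) * Real.sin α))) N with hJ
  calc ∫⁻ p, F p = ∫⁻ T, ∫⁻ V, ∫⁻ a, ∫⁻ q, F (relativePair T V a q) := lintegral_relativePair hF
    _ = ∫⁻ T, ∫⁻ V, ∫⁻ N, J T V N := by
        refine lintegral_congr fun T => lintegral_congr fun V => ?_
        rw [lintegral_polarRapidity hs (H := fun a q => F (relativePair T V a q)),
          ← lintegral_indicator measurableSet_Ici]
        exact hR.comp (by fun_prop : Measurable fun x : ℝ × ℝ => (T, V, x.1, x.2))
    _ = ∫⁻ U in Set.Ioi 0, ENNReal.ofReal (1 / U) * ∫⁻ V, ∫⁻ N, J (Real.log U) V N :=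
        lintegral_comp_log _
    _ = ∫⁻ U in Set.Ioi 0, ∫⁻ V, ∫⁻ W, J (Real.log U) V (U * W - V ^ 2) := by
        refine setLIntegral_congr_fun measurableSet_Ioi fun U hU => ?_
        rw [← lintegral_const_mul' _ _ (by simp)]
        refine lintegral_congr fun V => ?_
        exact lintegral_comp_mul_sub hU _ _
    _ = ∫⁻ U, ∫⁻ V, ∫⁻ W, fiberWeight s (U, V, W) * ∫⁻ α in Set.Ioo (-Real.pi) Real.pi,
          F (fiberMap s (U, V, W) α) := by
        rw [← lintegral_indicator measurableSet_Ioi]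
        refine lintegral_congr fun U => ?_
        by_cases hU : 0 < U
        · rw [Set.indicator_of_mem (Set.mem_Ioi.2 hU)]
          refine lintegral_congr fun V => lintegral_congr fun W => ?_
          by_cases hN : 4 * s ^ 2 ≤ U * W - V ^ 2
          · have h1 : (U, V, W) ∈ sumRegion s := ⟨hU, hN⟩
            rw [hJ, fiberWeight, Set.indicator_of_mem h1]
            simp only
            rw [Set.indicator_of_mem (Set.mem_Ici.2 hN)]
            rfl
          · have h1 : (U, V, W) ∉ sumRegion s := fun h => hN h.2
            rw [hJ, fiberWeight, Set.indicator_of_notMem h1, zero_mul]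
            simp only
            rw [Set.indicator_of_notMem (by simpa using hN)]
        · rw [Set.indicator_of_notMem (by simpa using hU)]
          symm
          have h1 : ∀ V W, (U, V, W) ∉ sumRegion s := fun V W h => hU h.1
          simp [fiberWeight, h1]
    _ = _ := by
        have hK : Measurable fun X : ℝ × ℝ × ℝ =>
            fiberWeight s X * ∫⁻ α in Set.Ioo (-Real.pi) Real.pi, F (fiberMap s X α) :=
          (measurable_fiberWeight s).mul hG.lintegral_prod_right'
        rw [Measure.volume_eq_prod, lintegral_prod _ hK.aemeasurable]
        refine lintegral_congr fun U => ?_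
        rw [Measure.volume_eq_prod, lintegral_prod]
        exact (hK.comp (by fun_prop)).aemeasurable

/-- The light-cone coordinates of the point of the hyperboloid with parameter `p`. -/
noncomputable def conePt (s : ℝ) (p : ℝ × ℝ) : ℝ × ℝ × ℝ :=
  (Real.exp p.1, p.2, (s ^ 2 + p.2 ^ 2) * Real.exp (-p.1))

theorem conePt_fiberMap {s : ℝ} (hs : 0 < s) {X : ℝ × ℝ × ℝ} (hX : X ∈ sumRegion s) (α : ℝ) :
    conePt s (fiberMap s X α).1 + conePt s (fiberMap s X α).2 = X := by
  obtain ⟨U, V, W⟩ := X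
  obtain ⟨hU, hN⟩ := hX
  simp only [coneSq] at hU hN
  set N := U * W - V ^ 2 with hNdef
  set ρ := √(N / 4 - s ^ 2) with hρ
  have hρ2 : ρ ^ 2 = N / 4 - s ^ 2 := Real.sq_sqrt (by linarith)
  set q := ρ * Real.sin α with hq
  set a := polarRapidity s ρ α with ha
  have hm : 0 < √(s ^ 2 + q ^ 2) := Real.sqrt_pos.2 (by positivity)
  have hsinh : √(s ^ 2 + q ^ 2) * Real.sinh (a / 2) = ρ * Real.cos α := by
    rw [ha, polarRapidity, mul_div_cancel_left₀ _ two_ne_zero, Real.sinh_arsinh, ← hq]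
    exact mul_div_cancel₀ _ hm.ne'
  -- This is $4(s^2+q^2)\cosh^2(a/2)=4(s^2+\rho^2)$, the identity that recovers the third coordinate
  -- $W$ of the sum.
  have hcosh : (s ^ 2 + q ^ 2) * (2 + Real.exp a + Real.exp (-a)) = N := by
    have h1 : Real.exp a + Real.exp (-a) = 2 + 4 * Real.sinh (a / 2) ^ 2 := by
      have h2 : Real.exp a = Real.exp (a / 2) * Real.exp (a / 2) := by
        rw [← Real.exp_add]; ring_nf
      have h3 : Real.exp (-a) = Real.exp (-(a / 2)) * Real.exp (-(a / 2)) := by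
        rw [← Real.exp_add]; ring_nf
      have h4 : Real.exp (a / 2) * Real.exp (-(a / 2)) = 1 := by
        rw [← Real.exp_add]; simp
      rw [Real.sinh_eq, h2, h3]
      linear_combination 2 * h4
    have h5 : (s ^ 2 + q ^ 2) * Real.sinh (a / 2) ^ 2 = (ρ * Real.cos α) ^ 2 := by
      have h7 := Real.sq_sqrt (add_nonneg (sq_nonneg s) (sq_nonneg q))
      rw [← hsinh]
      linear_combination -Real.sinh (a / 2) ^ 2 * h7
    have h6 := Real.sin_sq_add_cos_sq α
    calc (s ^ 2 + q ^ 2) * (2 + Real.exp a + Real.exp (-a))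
        = 4 * (s ^ 2 + q ^ 2) + 4 * ((s ^ 2 + q ^ 2) * Real.sinh (a / 2) ^ 2) := by
          rw [add_assoc, h1]; ring
      _ = 4 * s ^ 2 + 4 * ρ ^ 2 * (Real.sin α ^ 2 + Real.cos α ^ 2) := by rw [h5, hq]; ring
      _ = N := by rw [h6, hρ2]; ring
  have hE : Real.exp a * Real.exp (-a) = 1 := by rw [← Real.exp_add]; simp
  have hEa := Real.exp_pos a
  have hEna := Real.exp_pos (-a)
  have e1 : Real.exp (Real.log U - Real.log (1 + Real.exp (-a))) = U / (1 + Real.exp (-a)) := by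
    rw [Real.exp_sub, Real.exp_log hU, Real.exp_log (by positivity)]
  have e2 : Real.exp (Real.log U - Real.log (1 + Real.exp a)) = U / (1 + Real.exp a) := by
    rw [Real.exp_sub, Real.exp_log hU, Real.exp_log (by positivity)]
  have hθ : 1 - 1 / (1 + Real.exp (-a)) = 1 / (1 + Real.exp a) := by
    field_simp
    linear_combination hE
  have hfib : fiberMap s (U, V, W) α = relativePair (Real.log U) V a q := rfl
  rw [hfib]
  simp only [conePt, relativePair, Prod.mk_add_mk, Real.exp_neg (Real.log U - _), e1, e2, hθ]
  have hEi : Real.exp (-a) = (Real.exp a)⁻¹ := Real.exp_neg a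
  set x := Real.exp a with hx
  rw [hEi] at hcosh ⊢
  refine Prod.ext ?_ (Prod.ext ?_ ?_)
  · simp only
    field_simp
    ring
  · simp only
    field_simp
    ring
  · simp only
    have hW : W = (N + V ^ 2) / U := by rw [hNdef]; field_simp; ring
    rw [hW, ← hcosh]
    field_simp
    ring

/-! ### Light-cone coordinates and the measure `sigma` -/

/-- The light-cone coordinates `(τ + ξ₁, ξ₂, τ - ξ₁)`. -/
noncomputable def coneCoordLinear : SpaceTime 2 ≃ₗ[ℝ] ℝ × ℝ × ℝ where
  toFun X := (X.snd + X.fst 0, X.fst 1, X.snd - X.fst 0)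
  map_add' X Y := by
    refine Prod.ext ?_ (Prod.ext ?_ ?_) <;> simp <;> ring
  map_smul' r X := by
    refine Prod.ext ?_ (Prod.ext ?_ ?_) <;> simp <;> ring
  invFun x := WithLp.toLp 2 (!₂[(x.1 - x.2.2) / 2, x.2.1], (x.1 + x.2.2) / 2)
  left_inv X := by
    apply WithLp.ofLp_injective
    refine Prod.ext ?_ ?_
    · ext i
      fin_cases i <;> simp
    · simp
  right_inv x := by
    refine Prod.ext ?_ (Prod.ext ?_ ?_)
    · simp; ring
    · simp
    · simp; ring

/-- The light-cone coordinates as a continuous linear equivalence. -/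
noncomputable def coneCoord : SpaceTime 2 ≃L[ℝ] ℝ × ℝ × ℝ :=
  { coneCoordLinear with
    continuous_toFun := by
      change Continuous fun X : SpaceTime 2 => (X.snd + X.fst 0, X.fst 1, X.snd - X.fst 0)
      fun_prop
    continuous_invFun := by
      change Continuous fun x : ℝ × ℝ × ℝ =>
        (WithLp.toLp 2 (!₂[(x.1 - x.2.2) / 2, x.2.1], (x.1 + x.2.2) / 2) : SpaceTime 2)
      fun_prop }

theorem coneCoord_apply (X : SpaceTime 2) :
    coneCoord X = (X.snd + X.fst 0, X.fst 1, X.snd - X.fst 0) := rfl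

theorem coneCoord_symm_apply (x : ℝ × ℝ × ℝ) : coneCoord.symm x =
    WithLp.toLp 2 (!₂[(x.1 - x.2.2) / 2, x.2.1], (x.1 + x.2.2) / 2) := rfl

theorem coneCoord_symm_fst (x : ℝ × ℝ × ℝ) :
    (coneCoord.symm x).fst = !₂[(x.1 - x.2.2) / 2, x.2.1] := rfl

/-- The point of the hyperboloid with parameter `p`. -/
noncomputable def hypPt (s : ℝ) (p : ℝ × ℝ) : SpaceTime 2 := coneCoord.symm (conePt s p)

theorem coneCoord_hypPt (s : ℝ) (p : ℝ × ℝ) : coneCoord (hypPt s p) = conePt s p :=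
  coneCoord.apply_symm_apply _

theorem continuous_conePt (s : ℝ) : Continuous (conePt s) := by
  unfold conePt
  fun_prop

theorem continuous_hypPt (s : ℝ) : Continuous (hypPt s) :=
  coneCoord.symm.continuous.comp (continuous_conePt s)

theorem norm_sq_euclidean_two (y : EuclideanSpace ℝ (Fin 2)) : ‖y‖ ^ 2 = y 0 ^ 2 + y 1 ^ 2 := by
  rw [EuclideanSpace.norm_sq_eq]
  simp

theorem measurable_psi (d : ℕ) (s : ℝ) : Measurable (psi d s) := by
  unfold psi
  fun_prop

theorem toLp_psi_eq_hypPt {s : ℝ} (hs : 0 < s) (t v : ℝ) :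
    (WithLp.toLp 2 (!₂[(Real.exp t - √(s ^ 2 + v ^ 2) ^ 2 * Real.exp (-t)) / 2, v],
      psi 2 s !₂[(Real.exp t - √(s ^ 2 + v ^ 2) ^ 2 * Real.exp (-t)) / 2, v]) : SpaceTime 2) =
      hypPt s (t, v) := by
  have hm : √(s ^ 2 + v ^ 2) ^ 2 = s ^ 2 + v ^ 2 := Real.sq_sqrt (by positivity)
  have hE : Real.exp t * Real.exp (-t) = 1 := by rw [← Real.exp_add]; simp
  have hE1 := Real.exp_pos t
  have hE2 := Real.exp_pos (-t)
  rw [hm, hypPt, coneCoord_symm_apply, psi, norm_sq_euclidean_two]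
  simp only [conePt]
  congr 2
  simp only [Matrix.cons_val_zero, Matrix.cons_val_one]
  rw [show s ^ 2 + (((Real.exp t - (s ^ 2 + v ^ 2) * Real.exp (-t)) / 2) ^ 2 + v ^ 2) =
    ((Real.exp t + (s ^ 2 + v ^ 2) * Real.exp (-t)) / 2) ^ 2 by
      linear_combination -(s ^ 2 + v ^ 2) * hE]
  exact Real.sqrt_sq (by positivity)

theorem lintegral_euclidean_two (h : EuclideanSpace ℝ (Fin 2) → ℝ≥0∞) (hh : Measurable h) :
    ∫⁻ y, h y = ∫⁻ v, ∫⁻ x, h !₂[x, v] := by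
  have h1 := (EuclideanSpace.volume_preserving_symm_measurableEquiv_toLp (Fin 2)).symm
  have h2 := (volume_preserving_finTwoArrow ℝ).symm
  have h3 := (h2.trans h1).lintegral_comp hh
  rw [← h3, Measure.volume_eq_prod, lintegral_prod_symm]
  · rfl
  · exact (hh.comp (h2.trans h1).measurable).aemeasurable

/-- For fixed $\xi_2=v$ and $m^2=s^2+v^2$, the point has $\xi_1=(e^t-m^2e^{-t})/2$, and
$d\xi_1/\sqrt{m^2+\xi_1^2}=dt$. -/
theorem sigma_eq_map {s : ℝ} (hs : 0 < s) :
    sigma 2 s = (volume : Measure (ℝ × ℝ)).map (hypPt s) := by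
  have hpsi := measurable_psi 2 s
  have hmk : Measurable fun y : EuclideanSpace ℝ (Fin 2) =>
      (WithLp.toLp 2 (y, psi 2 s y) : SpaceTime 2) :=
    (WithLp.volume_preserving_toLp (EuclideanSpace ℝ (Fin 2)) ℝ).measurable.comp
      (measurable_id.prodMk hpsi)
  refine Measure.ext_of_lintegral _ fun g hg => ?_
  rw [sigma, lintegral_map hg hmk, lintegral_map hg (continuous_hypPt s).measurable,
    lintegral_withDensity_eq_lintegral_mul _
      (f := fun y => ENNReal.ofReal (1 / psi 2 s y)) (by fun_prop)
      (g := fun y => g (WithLp.toLp 2 (y, psi 2 s y))) (hg.comp hmk),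
    lintegral_euclidean_two _ (Measurable.mul (by fun_prop)
      (show Measurable fun y => g (WithLp.toLp 2 (y, psi 2 s y)) from hg.comp hmk)),
    Measure.volume_eq_prod,
    lintegral_prod_symm (fun p => g (hypPt s p))
      (hg.comp (continuous_hypPt s).measurable).aemeasurable]
  refine lintegral_congr fun v => ?_
  have hm : 0 < √(s ^ 2 + v ^ 2) := Real.sqrt_pos.2 (by positivity)
  simp only [← toLp_psi_eq_hypPt hs]
  rw [lintegral_comp_exp_sub hm (fun x => g (WithLp.toLp 2 (!₂[x, v], psi 2 s !₂[x, v])))]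
  refine lintegral_congr fun x => ?_
  simp only [Pi.mul_apply]
  congr 3
  rw [psi, norm_sq_euclidean_two, Real.sq_sqrt (by positivity)]
  simp only [Matrix.cons_val_zero, Matrix.cons_val_one]
  ring_nf

/-- Uniqueness of Haar measure. The value of the factor is irrelevant: the upper and lower bounds
for the extension norm carry the same constant, which cancels. -/
theorem exists_volume_eq_smul_map_coneCoord : ∃ c : ℝ≥0∞, c ≠ 0 ∧ c ≠ ∞ ∧
    (volume : Measure (ℝ × ℝ × ℝ)) = c • (volume : Measure (SpaceTime 2)).map coneCoord := by
  have : (Measure.map coneCoord (volume : Measure (SpaceTime 2))).IsAddHaarMeasure :=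
    coneCoord.isAddHaarMeasure_map _
  have : (volume : Measure (ℝ × ℝ)).IsAddHaarMeasure := Measure.prod.instIsAddHaarMeasure _ _
  have : (volume : Measure (ℝ × ℝ × ℝ)).IsAddHaarMeasure :=
    Measure.prod.instIsAddHaarMeasure _ _
  have h := Measure.isAddLeftInvariant_eq_smul (volume : Measure (ℝ × ℝ × ℝ))
    (Measure.map coneCoord (volume : Measure (SpaceTime 2)))
  refine ⟨_, ?_, ENNReal.coe_ne_top, h⟩
  simpa using (Measure.addHaarScalarFactor_pos_of_isAddHaarMeasure _ _).ne'

/-! ### Integration over fibres and Cauchy–Schwarz -/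

section FiberIntegration

variable {E A Y : Type*} [MeasurableSpace E] [MeasurableSpace A] [MeasurableSpace Y]
  {μ : Measure E} {l : Measure A} [IsFiniteMeasure l] {ν : Measure Y}
  {w : E → ℝ≥0∞} {Ψ : E × A → Y} {S : Y → E}

/-- The density of the push-forward of `F ν`. -/
noncomputable def fiberIntegral (l : Measure A) (w : E → ℝ≥0∞) (Ψ : E × A → Y) (F : Y → ℂ)
    (X : E) : ℂ := (w X).toReal • ∫ α, F (Ψ (X, α)) ∂l

/-- In the application `E` is the space of sums, `A` the angles, `Y` the pairs of points, and `S`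
the addition. -/
theorem lintegral_fiber (hw : Measurable w) (hΨ : Measurable Ψ)
    (hν : ν = ((μ.prod l).withDensity fun x => w x.1).map Ψ) {F : Y → ℝ≥0∞}
    (hF : Measurable F) : ∫⁻ y, F y ∂ν = ∫⁻ X, w X * ∫⁻ α, F (Ψ (X, α)) ∂l ∂μ := by
  have hFΨ : Measurable fun x => F (Ψ x) := hF.comp hΨ
  have hw1 : Measurable fun x : E × A => w x.1 := hw.comp measurable_fst
  rw [hν, lintegral_map hF hΨ, lintegral_withDensity_eq_lintegral_mul _ hw1 hFΨ,
    lintegral_prod _ (hw1.mul hFΨ).aemeasurable]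
  refine lintegral_congr fun X => ?_
  simp only [Pi.mul_apply]
  rw [lintegral_const_mul _ (show Measurable fun α => F (Ψ (X, α)) from
    hFΨ.comp measurable_prodMk_left)]

theorem integral_fiber [SFinite μ] (hw : Measurable w) (hw' : ∀ X, w X ≠ ∞) (hΨ : Measurable Ψ)
    (hν : ν = ((μ.prod l).withDensity fun x => w x.1).map Ψ) {F : Y → ℂ}
    (hFm : Measurable F) (hF : Integrable F ν) :
    Integrable (fiberIntegral l w Ψ F) μ ∧
      ∫ y, F y ∂ν = ∫ X, fiberIntegral l w Ψ F X ∂μ := by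
  have hw1 : Measurable fun x : E × A => w x.1 := hw.comp measurable_fst
  have hlt : ∀ᵐ x ∂(μ.prod l), w x.1 < ∞ := Eventually.of_forall fun x => (hw' x.1).lt_top
  have hI : Integrable (fun x : E × A => (w x.1).toReal • F (Ψ x)) (μ.prod l) := by
    rw [hν] at hF
    exact (integrable_withDensity_iff_integrable_smul' hw1 hlt).1
      ((integrable_map_measure hFm.aestronglyMeasurable hΨ.aemeasurable).1 hF)
  have he : ∀ X, ∫ α, (w X).toReal • F (Ψ (X, α)) ∂l = fiberIntegral l w Ψ F X := fun X =>
    integral_smul _ _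
  constructor
  · have := hI.integral_prod_left
    simpa only [he] using this
  · rw [hν, integral_map hΨ.aemeasurable hFm.aestronglyMeasurable,
      integral_withDensity_eq_integral_toReal_smul hw1 hlt, integral_prod _ hI]
    simp only [he]

/-- Cauchy–Schwarz on each fibre against the constant function 1. One factor $w$ is absorbed in the
measure $\nu$; the other survives as $w\circ S$ and becomes the kernel. -/
theorem lintegral_enorm_sq_fiberIntegral_le (hw : Measurable w) (hw' : ∀ X, w X ≠ ∞)
    (hΨ : Measurable Ψ) (hν : ν = ((μ.prod l).withDensity fun x => w x.1).map Ψ)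
    (hS : Measurable S) (hSΨ : ∀ X α, w X ≠ 0 → S (Ψ (X, α)) = X) {F : Y → ℂ}
    (hFm : Measurable F) :
    ∫⁻ X, ‖fiberIntegral l w Ψ F X‖ₑ ^ 2 ∂μ ≤
      ∫⁻ y, ‖F y‖ₑ ^ 2 * (l Set.univ * w (S y)) ∂ν := by
  rw [lintegral_fiber hw hΨ hν
    (F := fun y => ‖F y‖ₑ ^ 2 * (l Set.univ * w (S y))) (by fun_prop)]
  refine lintegral_mono fun X => ?_
  by_cases hX : w X = 0
  · simp [fiberIntegral, hX]
  simp only [hSΨ X _ hX]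
  have hFX : Measurable fun α => F (Ψ (X, α)) := hFm.comp (hΨ.comp measurable_prodMk_left)
  rw [lintegral_mul_const _ (by fun_prop), fiberIntegral, enorm_smul, mul_pow,
    Real.enorm_of_nonneg ENNReal.toReal_nonneg, ENNReal.ofReal_toReal (hw' X)]
  have hCS : (∫⁻ α, ‖F (Ψ (X, α))‖ₑ ∂l) ^ 2 ≤ (∫⁻ α, ‖F (Ψ (X, α))‖ₑ ^ 2 ∂l) * l Set.univ := by
    have := ENNReal.lintegral_mul_le_Lp_mul_Lq l Real.HolderConjugate.two_two
      (f := fun α => ‖F (Ψ (X, α))‖ₑ) (g := fun _ => 1) (by fun_prop) (by fun_prop)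
    simp only [Pi.mul_apply, mul_one, ENNReal.one_rpow, lintegral_const, one_mul] at this
    calc _ ≤ _ := pow_le_pow_left' this 2
      _ = _ := by
        rw [mul_pow, ← ENNReal.rpow_natCast, ← ENNReal.rpow_mul, ← ENNReal.rpow_natCast,
          ← ENNReal.rpow_mul]
        simp
  calc w X ^ 2 * ‖∫ α, F (Ψ (X, α)) ∂l‖ₑ ^ 2
      ≤ w X ^ 2 * ((∫⁻ α, ‖F (Ψ (X, α))‖ₑ ^ 2 ∂l) * l Set.univ) := by
        gcongr
        exact (pow_le_pow_left' (enorm_integral_le_lintegral_enorm _) 2).trans hCS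
    _ = _ := by ring

/-- A function of the sum is constant on the fibres, which is the equality case of Cauchy–Schwarz.
-/
theorem lintegral_enorm_sq_fiberIntegral_comp (hw : Measurable w) (hw' : ∀ X, w X ≠ ∞)
    (hΨ : Measurable Ψ) (hν : ν = ((μ.prod l).withDensity fun x => w x.1).map Ψ)
    (hS : Measurable S) (hSΨ : ∀ X α, w X ≠ 0 → S (Ψ (X, α)) = X) {H : E → ℂ}
    (hH : Measurable H) :
    ∫⁻ X, ‖fiberIntegral l w Ψ (H ∘ S) X‖ₑ ^ 2 ∂μ =
      ∫⁻ y, ‖H (S y)‖ₑ ^ 2 * (l Set.univ * w (S y)) ∂ν := by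
  rw [lintegral_fiber hw hΨ hν
    (F := fun y => ‖H (S y)‖ₑ ^ 2 * (l Set.univ * w (S y))) (by fun_prop)]
  refine lintegral_congr fun X => ?_
  by_cases hX : w X = 0
  · simp [fiberIntegral, hX]
  have hl : ‖l.real Set.univ‖ₑ = l Set.univ := by
    rw [Real.enorm_of_nonneg measureReal_nonneg, ofReal_measureReal]
  simp only [fiberIntegral, Function.comp_apply, hSΨ X _ hX, integral_const, lintegral_const,
    enorm_smul, hl, Real.enorm_of_nonneg ENNReal.toReal_nonneg, ENNReal.ofReal_toReal (hw' X)]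
  ring

end FiberIntegration

/-! ### Plancherel for integrable and square-integrable functions -/

section Plancherel

open FourierTransform

variable {V : Type*} [NormedAddCommGroup V] [InnerProductSpace ℝ V] [FiniteDimensional ℝ V]
  [MeasurableSpace V] [BorelSpace V]

theorem ae_eq_of_integral_schwartz_eq {g g' : V → ℂ} (hg : LocallyIntegrable g)
    (hg' : LocallyIntegrable g') (h : ∀ φ : 𝓢(V, ℂ), ∫ x, g x * φ x = ∫ x, g' x * φ x) :
    g =ᵐ[volume] g' := by
  refine ae_eq_of_integral_contDiff_smul_eq hg hg' fun u hu hu' => ?_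
  have h1 : HasCompactSupport (Complex.ofRealCLM ∘ u) := hu'.comp_left rfl
  have h2 : ContDiff ℝ (⊤ : ℕ∞) (Complex.ofRealCLM ∘ u) := Complex.ofRealCLM.contDiff.comp hu
  simpa [mul_comm] using h (h1.toSchwartzMap h2)

/-- The $L^2$ Fourier transform is an isometry. It agrees almost everywhere with the integral
formula because both have the same pairings with Schwartz functions. -/
theorem lintegral_enorm_sq_fourier {G : V → ℂ} (h1 : Integrable G) (h2 : MemLp G 2) :
    ∫⁻ x, ‖𝓕 G x‖ₑ ^ 2 = ∫⁻ x, ‖G x‖ₑ ^ 2 := by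
  have hnorm := Lp.norm_fourier_eq (h2.toLp G)
  set g := 𝓕 (h2.toLp G) with hg
  have hcont : Continuous (𝓕 G) := VectorFourier.fourierIntegral_continuous
    Real.continuous_fourierChar (L := innerₗ V) continuous_inner h1
  have hae : g =ᵐ[volume] 𝓕 G := by
    refine ae_eq_of_integral_schwartz_eq ((Lp.memLp g).locallyIntegrable one_le_two)
      hcont.locallyIntegrable fun φ => ?_
    have e1 := congrArg (fun T : 𝓢'(V, ℂ) => T φ)
      (Lp.fourier_toTemperedDistribution_eq (h2.toLp G))
    simp only [TemperedDistribution.fourier_apply, Lp.toTemperedDistribution_apply] at e1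
    have e2 := VectorFourier.integral_fourierIntegral_smul_eq_flip (L := innerₗ V)
      (μ := volume) (ν := volume) Real.continuous_fourierChar continuous_inner φ.integrable h1
    have e3 : ∫ x, (𝓕 φ) x • (h2.toLp G) x = ∫ x, (𝓕 φ) x • G x := by
      refine integral_congr_ae ?_
      filter_upwards [h2.coeFn_toLp] with x hx
      rw [hx]
    rw [flip_innerₗ] at e2
    calc ∫ x, g x * φ x = ∫ x, φ x • g x := by simp [mul_comm]
      _ = ∫ x, (𝓕 φ) x • G x := by rw [← e3, e1]
      _ = ∫ x, φ x • 𝓕 G x := e2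
      _ = _ := by simp [mul_comm]
  have key : eLpNorm (𝓕 G) 2 volume = eLpNorm G 2 volume := by
    rw [← eLpNorm_congr_ae hae, ← eLpNorm_congr_ae h2.coeFn_toLp]
    rw [Lp.norm_def, Lp.norm_def,
      ENNReal.toReal_eq_toReal_iff' (Lp.eLpNorm_ne_top _) (Lp.eLpNorm_ne_top _)] at hnorm
    exact hnorm
  have hpow : ∀ H : V → ℂ, eLpNorm H 2 volume ^ 2 = ∫⁻ x, ‖H x‖ₑ ^ 2 := fun H => by
    have := eLpNorm_nnreal_pow_eq_lintegral (f := H) (p := 2) (μ := volume) two_ne_zero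
    simpa using this
  rw [← hpow, ← hpow, key]

end Plancherel

theorem fourierHat_eq_fourier (d : ℕ) (φ : SpaceTime d → ℂ) (ζ : SpaceTime d) :
    fourierHat d φ ζ = FourierTransform.fourier φ ((2 * Real.pi)⁻¹ • ζ) := by
  rw [Real.fourier_eq', fourierHat]
  refine integral_congr_ae (Eventually.of_forall fun z => ?_)
  simp only [inner_smul_right, smul_eq_mul]
  congr 2
  rw [show -2 * Real.pi * ((2 * Real.pi)⁻¹ * inner ℝ z ζ) = - inner ℝ z ζ by
    have := Real.pi_ne_zero
    field_simp]
  push_cast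
  ring

theorem exists_lintegral_enorm_sq_fourierHat : ∃ c : ℝ≥0∞, c ≠ 0 ∧ c ≠ ∞ ∧
    ∀ G : SpaceTime 2 → ℂ, Integrable G → MemLp G 2 →
      ∫⁻ x, ‖fourierHat 2 G x‖ₑ ^ 2 = c * ∫⁻ x, ‖G x‖ₑ ^ 2 := by
  have hπ : (2 * Real.pi)⁻¹ ≠ 0 := by positivity
  have hmap := Measure.map_addHaar_smul (volume : Measure (SpaceTime 2)) hπ
  refine ⟨ENNReal.ofReal |((2 * Real.pi)⁻¹ ^ Module.finrank ℝ (SpaceTime 2))⁻¹|, ?_,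
    ENNReal.ofReal_ne_top, fun G h1 h2 => ?_⟩
  · simp only [ne_eq, ENNReal.ofReal_eq_zero, not_le]
    positivity
  · simp only [fourierHat_eq_fourier]
    have hcont : Continuous (FourierTransform.fourier G) :=
      VectorFourier.fourierIntegral_continuous Real.continuous_fourierChar
        (L := innerₗ (SpaceTime 2)) continuous_inner h1
    rw [← lintegral_map (μ := volume) (g := fun x : SpaceTime 2 => (2 * Real.pi)⁻¹ • x)
      (f := fun x => ‖FourierTransform.fourier G x‖ₑ ^ 2) (by fun_prop) (by fun_prop), hmap,
      lintegral_smul_measure, lintegral_enorm_sq_fourier h1 h2, smul_eq_mul]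

/-! ### The quartic identity and the kernel -/

/-- The sum of two points of the hyperboloid. -/
noncomputable def pairSum (s : ℝ) (y : (ℝ × ℝ) × (ℝ × ℝ)) : SpaceTime 2 :=
  hypPt s y.1 + hypPt s y.2

theorem continuous_pairSum (s : ℝ) : Continuous (pairSum s) := by
  have := continuous_hypPt s
  unfold pairSum
  fun_prop

/-- Lebesgue measure on the polar angles in `(-π, π)`. -/
noncomputable abbrev angleMeasure : Measure ℝ := volume.restrict (Set.Ioo (-Real.pi) Real.pi)

/-- The parametrization of the fibres of the addition. -/
noncomputable def fiberParam (s : ℝ) (x : SpaceTime 2 × ℝ) : (ℝ × ℝ) × (ℝ × ℝ) :=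
  fiberMap s (coneCoord x.1) x.2

theorem measurable_fiberParam (s : ℝ) : Measurable (fiberParam s) :=
  (measurable_fiberMap s).comp
    ((coneCoord.continuous.measurable.comp measurable_fst).prodMk measurable_snd)

theorem measurable_fiberWeight_coneCoord (s : ℝ) (c : ℝ≥0∞) :
    Measurable fun X : SpaceTime 2 => c * fiberWeight s (coneCoord X) :=
  ((measurable_fiberWeight s).comp coneCoord.continuous.measurable).const_mul c

theorem fiberWeight_ne_top (s : ℝ) (x : ℝ × ℝ × ℝ) : fiberWeight s x ≠ ∞ := by
  unfold fiberWeight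
  by_cases h : x ∈ sumRegion s
  · rw [Set.indicator_of_mem h]
    exact ENNReal.ofReal_ne_top
  · simp [h]

theorem pairSum_fiberParam {s : ℝ} (hs : 0 < s) {X : SpaceTime 2} {α : ℝ}
    (hX : fiberWeight s (coneCoord X) ≠ 0) : pairSum s (fiberParam s (X, α)) = X := by
  have hX' : coneCoord X ∈ sumRegion s := by
    by_contra h
    exact hX (Set.indicator_of_notMem h _)
  rw [pairSum, hypPt, hypPt, ← map_add, fiberParam, conePt_fiberMap hs hX',
    ContinuousLinearEquiv.symm_apply_apply]

theorem exists_volume_eq_map_fiberParam {s : ℝ} (hs : 0 < s) : ∃ c : ℝ≥0∞, c ≠ 0 ∧ c ≠ ∞ ∧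
    (volume : Measure ((ℝ × ℝ) × (ℝ × ℝ))) =
      (((volume : Measure (SpaceTime 2)).prod angleMeasure).withDensity
        fun x => c * fiberWeight s (coneCoord x.1)).map (fiberParam s) := by
  obtain ⟨c, hc0, hc, hvol⟩ := exists_volume_eq_smul_map_coneCoord
  refine ⟨c, hc0, hc, Measure.ext_of_lintegral _ fun F hF => ?_⟩
  have hG : Measurable fun x : (ℝ × ℝ × ℝ) × ℝ => F (fiberMap s x.1 x.2) :=
    hF.comp (measurable_fiberMap s)
  rw [lintegral_fiber (μ := (volume : Measure (SpaceTime 2))) (l := angleMeasure)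
    (measurable_fiberWeight_coneCoord s c) (measurable_fiberParam s) rfl hF,
    lintegral_fiberMap hs hF, hvol, lintegral_smul_measure, lintegral_map
      (show Measurable fun x => fiberWeight s x * ∫⁻ α, F (fiberMap s x α) ∂angleMeasure from
        (measurable_fiberWeight s).mul hG.lintegral_prod_right') coneCoord.continuous.measurable,
    smul_eq_mul, ← lintegral_const_mul' _ _ hc]
  refine lintegral_congr fun X => ?_
  rw [mul_assoc]
  rfl

/-- The reverse triangle inequality for timelike vectors, proved by writing the difference as a
positive multiple of a sum of squares. -/
theorem conePt_add_sq_bound {s : ℝ} (p p' : ℝ × ℝ) :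
    4 * s ^ 2 ≤ coneSq (conePt s p + conePt s p') := by
  obtain ⟨t, v⟩ := p
  obtain ⟨t', v'⟩ := p'
  simp only [coneSq, conePt, Prod.mk_add_mk]
  have h1 : Real.exp t * Real.exp (-t) = 1 := by rw [← Real.exp_add]; simp
  have h2 : Real.exp t' * Real.exp (-t') = 1 := by rw [← Real.exp_add]; simp
  have e1 := Real.exp_pos t
  have e2 := Real.exp_pos t'
  have e3 := Real.exp_pos (-t)
  have e4 := Real.exp_pos (-t')
  set a := Real.exp t
  set b := Real.exp t'
  set a' := Real.exp (-t)
  set b' := Real.exp (-t')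
  have key : (a + b) * ((s ^ 2 + v ^ 2) * a' + (s ^ 2 + v' ^ 2) * b') - (v + v') ^ 2 - 4 * s ^ 2 =
      a' * b' * (s ^ 2 * (a - b) ^ 2 + (a * v' - b * v) ^ 2) := by
    linear_combination
      (s ^ 2 + v ^ 2 - a * b' * (s ^ 2 + v' ^ 2) + 2 * (s ^ 2 + v * v') * (b * b')) * h1 +
      (s ^ 2 + v' ^ 2 - b * a' * (s ^ 2 + v ^ 2) + 2 * (s ^ 2 + v * v')) * h2
  have : 0 ≤ a' * b' * (s ^ 2 * (a - b) ^ 2 + (a * v' - b * v) ^ 2) := by positivity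
  linarith

theorem coneCoord_pairSum (s : ℝ) (y : (ℝ × ℝ) × (ℝ × ℝ)) :
    coneCoord (pairSum s y) = conePt s y.1 + conePt s y.2 := by
  rw [pairSum, map_add, coneCoord_hypPt, coneCoord_hypPt]

/-- The kernel `1 / √((x + y) · J (x + y))`. -/
noncomputable def pairKernel (s : ℝ) (y : (ℝ × ℝ) × (ℝ × ℝ)) : ℝ≥0∞ :=
  ENNReal.ofReal (1 / √(coneSq (conePt s y.1 + conePt s y.2)))

theorem measurable_pairKernel (s : ℝ) : Measurable (pairKernel s) := by
  have h1 := measurable_coneSq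
  have h2 := (continuous_conePt s).measurable
  unfold pairKernel
  fun_prop

theorem pairKernel_le {s : ℝ} (hs : 0 < s) (y : (ℝ × ℝ) × (ℝ × ℝ)) :
    pairKernel s y ≤ ENNReal.ofReal (1 / (2 * s)) := by
  refine ENNReal.ofReal_le_ofReal (one_div_le_one_div_of_le (by positivity) ?_)
  refine Real.le_sqrt_of_sq_le ?_
  have := conePt_add_sq_bound (s := s) y.1 y.2
  linarith [show (2 * s) ^ 2 = 4 * s ^ 2 by ring]

theorem fiberWeight_pairSum (s : ℝ) (y : (ℝ × ℝ) × (ℝ × ℝ)) :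
    fiberWeight s (coneCoord (pairSum s y)) = ENNReal.ofReal (1 / 2) * pairKernel s y := by
  have hmem : coneCoord (pairSum s y) ∈ sumRegion s := by
    rw [coneCoord_pairSum]
    exact ⟨add_pos (Real.exp_pos _) (Real.exp_pos _), conePt_add_sq_bound _ _⟩
  rw [fiberWeight, Set.indicator_of_mem hmem, coneCoord_pairSum, pairKernel,
    ← ENNReal.ofReal_mul (by norm_num)]
  congr 1
  rw [one_div_mul_one_div]

/-- The Fourier transform of `f σ_s` for an integrable `f`, which is `h` in the coordinates. -/
noncomputable def extFn (s : ℝ) (h : ℝ × ℝ → ℂ) (x : SpaceTime 2) : ℂ :=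
  ∫ p, Complex.exp (-(Complex.I * (inner ℝ (hypPt s p) x : ℝ))) * h p

/-- The quadrilinear form `∫∫ |h(p)|² |h(p')|² / √((p + p') · J (p + p'))`. -/
noncomputable def pairEnergy (s : ℝ) (h : ℝ × ℝ → ℂ) : ℝ≥0∞ :=
  ∫⁻ y : (ℝ × ℝ) × (ℝ × ℝ), ‖h y.1‖ₑ ^ 2 * ‖h y.2‖ₑ ^ 2 * pairKernel s y

theorem norm_cexp_neg_I_mul (r : ℝ) : ‖Complex.exp (-(Complex.I * (r : ℂ)))‖ = 1 := by
  rw [show -(Complex.I * (r : ℂ)) = ((-r : ℝ) : ℂ) * Complex.I by push_cast; ring]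
  exact Complex.norm_exp_ofReal_mul_I _

theorem lintegral_enorm_sq_mul {α : Type*} [MeasureSpace α] [SFinite (volume : Measure α)]
    {h : α → ℂ} (hm : Measurable h) :
    ∫⁻ y : α × α, ‖h y.1 * h y.2‖ₑ ^ 2 = (∫⁻ p, ‖h p‖ₑ ^ 2) ^ 2 := by
  simp only [enorm_mul, mul_pow]
  rw [Measure.volume_eq_prod, lintegral_prod_mul (f := fun p => ‖h p‖ₑ ^ 2)
    (g := fun p => ‖h p‖ₑ ^ 2) (by fun_prop) (by fun_prop)]
  ring

theorem lintegral_enorm_sq_lt_top {α : Type*} [MeasurableSpace α] {μ : Measure α} {h : α → ℂ}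
    (h2 : MemLp h 2 μ) : ∫⁻ p, ‖h p‖ₑ ^ 2 ∂μ < ∞ := by
  have := lintegral_rpow_enorm_lt_top_of_eLpNorm_lt_top two_ne_zero ENNReal.ofNat_ne_top h2.2
  simpa using this

/-- Plancherel applied to the density of $h\sigma_s*h\sigma_s$, combined with fibrewise
Cauchy–Schwarz. The same `C` in the inequality and in the equality case is what makes the estimate
sharp. -/
theorem exists_lintegral_extFn_pow_four {s : ℝ} (hs : 0 < s) : ∃ C : ℝ≥0∞, C ≠ 0 ∧ C ≠ ∞ ∧
    (∀ h : ℝ × ℝ → ℂ, Measurable h → Integrable h → MemLp h 2 →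
      ∫⁻ x, ‖extFn s h x‖ₑ ^ 4 ≤ C * pairEnergy s h) ∧
    (∀ h : ℝ × ℝ → ℂ, Measurable h → Integrable h → MemLp h 2 →
      (∃ H : SpaceTime 2 → ℂ, Measurable H ∧ ∀ y, h y.1 * h y.2 = H (pairSum s y)) →
      ∫⁻ x, ‖extFn s h x‖ₑ ^ 4 = C * pairEnergy s h) := by
  obtain ⟨cP, hcP0, hcP, hP⟩ := exists_lintegral_enorm_sq_fourierHat
  obtain ⟨c, hc0, hc, hvol⟩ := exists_volume_eq_map_fiberParam hs
  set w : SpaceTime 2 → ℝ≥0∞ := fun X => c * fiberWeight s (coneCoord X) with hw_def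
  have hw : Measurable w := measurable_fiberWeight_coneCoord s c
  have hw' : ∀ X, w X ≠ ∞ := fun X => ENNReal.mul_ne_top hc (fiberWeight_ne_top s _)
  have hΨ := measurable_fiberParam s
  have hS : Measurable (pairSum s) := (continuous_pairSum s).measurable
  have hSΨ : ∀ X α, w X ≠ 0 → pairSum s (fiberParam s (X, α)) = X := fun X α hX =>
    pairSum_fiberParam hs (right_ne_zero_of_mul hX)
  have hl : angleMeasure Set.univ ≠ ∞ := measure_ne_top _ _
  have hl0 : angleMeasure Set.univ ≠ 0 := by
    simp [Real.pi_pos]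
  set C₁ : ℝ≥0∞ := angleMeasure Set.univ * (c * ENNReal.ofReal (1 / 2)) with hC₁
  have hweight : ∀ y, angleMeasure Set.univ * w (pairSum s y) = C₁ * pairKernel s y := fun y => by
    rw [hw_def, hC₁]
    simp only [fiberWeight_pairSum]
    ring
  have hC₁0 : C₁ ≠ 0 := mul_ne_zero hl0 (mul_ne_zero hc0 (by simp))
  have hC₁' : C₁ ≠ ∞ := ENNReal.mul_ne_top hl (ENNReal.mul_ne_top hc ENNReal.ofReal_ne_top)
  have henergy : ∀ h : ℝ × ℝ → ℂ, Measurable h →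
      ∫⁻ y : (ℝ × ℝ) × (ℝ × ℝ), ‖h y.1 * h y.2‖ₑ ^ 2 * (angleMeasure Set.univ * w (pairSum s y)) =
        C₁ * pairEnergy s h := fun h hm => by
    rw [pairEnergy, ← lintegral_const_mul' _ _ hC₁']
    refine lintegral_congr fun y => ?_
    rw [hweight, enorm_mul, mul_pow]
    ring
  have main : ∀ h : ℝ × ℝ → ℂ, Measurable h → Integrable h → MemLp h 2 →
      ∫⁻ x, ‖extFn s h x‖ₑ ^ 4 = cP * ∫⁻ X,
        ‖fiberIntegral angleMeasure w (fiberParam s) (fun y => h y.1 * h y.2) X‖ₑ ^ 2 := by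
    intro h hm h1 h2
    set F : (ℝ × ℝ) × (ℝ × ℝ) → ℂ := fun y => h y.1 * h y.2 with hF
    have hFm : Measurable F := by fun_prop
    have hFi : Integrable F := h1.mul_prod h1
    set G := fiberIntegral angleMeasure w (fiberParam s) F with hG
    have hGi : Integrable G := (integral_fiber hw hw' hΨ hvol hFm hFi).1
    -- Plancherel needs the density in $L^2$; this follows from Cauchy–Schwarz and the boundedness
    -- of the kernel.
    have hG2 : MemLp G 2 := by
      refine ⟨hGi.1, ?_⟩
      rw [eLpNorm_lt_top_iff_lintegral_rpow_enorm_lt_top two_ne_zero ENNReal.ofNat_ne_top]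
      have hle := lintegral_enorm_sq_fiberIntegral_le hw hw' hΨ hvol hS hSΨ hFm
      have hle2 : ∫⁻ y, ‖F y‖ₑ ^ 2 * (angleMeasure Set.univ * w (pairSum s y)) ≤
          ∫⁻ y, ‖F y‖ₑ ^ 2 * (C₁ * ENNReal.ofReal (1 / (2 * s))) := by
        refine lintegral_mono fun y => ?_
        rw [hweight]
        gcongr
        exact pairKernel_le hs y
      rw [lintegral_mul_const _ (by fun_prop), lintegral_enorm_sq_mul hm] at hle2
      have hfin : (∫⁻ p, ‖h p‖ₑ ^ 2) ^ 2 * (C₁ * ENNReal.ofReal (1 / (2 * s))) < ∞ :=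
        ENNReal.mul_lt_top (ENNReal.pow_lt_top (lintegral_enorm_sq_lt_top h2))
          (ENNReal.mul_lt_top hC₁'.lt_top ENNReal.ofReal_lt_top)
      simpa using (hle.trans hle2).trans_lt hfin
    rw [← hP G hGi hG2]
    refine lintegral_congr fun x => ?_
    -- By Fubini the square is an integral over pairs, and its phase depends only on their sum,
    -- hence passes through the fibre integral.
    have hsq : extFn s h x ^ 2 = fourierHat 2 G x := by
      have e1 : extFn s h x ^ 2 = ∫ y : (ℝ × ℝ) × (ℝ × ℝ),
          Complex.exp (-(Complex.I * (inner ℝ (pairSum s y) x : ℝ))) * F y := by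
        rw [sq, extFn, Measure.volume_eq_prod (ℝ × ℝ) (ℝ × ℝ), ← integral_prod_mul]
        refine integral_congr_ae (Eventually.of_forall fun y => ?_)
        simp only [pairSum, inner_add_left, Complex.ofReal_add, mul_add, neg_add, Complex.exp_add,
          hF]
        ring
      have hcont : Continuous fun y : (ℝ × ℝ) × (ℝ × ℝ) =>
          Complex.exp (-(Complex.I * (inner ℝ (pairSum s y) x : ℝ))) := by
        have := continuous_pairSum s
        fun_prop
      have hEi : Integrable fun y : (ℝ × ℝ) × (ℝ × ℝ) =>
          Complex.exp (-(Complex.I * (inner ℝ (pairSum s y) x : ℝ))) * F y := by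
        refine hFi.bdd_mul (c := 1) hcont.aestronglyMeasurable (Eventually.of_forall fun y => ?_)
        rw [norm_cexp_neg_I_mul]
      have hEm : Measurable fun y : (ℝ × ℝ) × (ℝ × ℝ) =>
          Complex.exp (-(Complex.I * (inner ℝ (pairSum s y) x : ℝ))) * F y :=
        hcont.measurable.mul hFm
      rw [e1, (integral_fiber hw hw' hΨ hvol hEm hEi).2, fourierHat]
      refine integral_congr_ae (Eventually.of_forall fun X => ?_)
      simp only [hG, fiberIntegral]
      by_cases hX : w X = 0
      · simp [hX]
      · simp only [hSΨ X _ hX]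
        rw [integral_const_mul, Complex.real_smul, Complex.real_smul]
        ring
    rw [← hsq, enorm_pow]
    ring
  refine ⟨cP * C₁, mul_ne_zero hcP0 hC₁0, ENNReal.mul_ne_top hcP hC₁', ?_, ?_⟩
  · intro h hm h1 h2
    rw [main h hm h1 h2, mul_assoc, ← henergy h hm]
    gcongr
    exact lintegral_enorm_sq_fiberIntegral_le hw hw' hΨ hvol hS hSΨ (by fun_prop)
  · rintro h hm h1 h2 ⟨H, hHm, hH⟩
    rw [main h hm h1 h2, mul_assoc, ← henergy h hm]
    simp only [hH]
    congr 1
    exact lintegral_enorm_sq_fiberIntegral_comp hw hw' hΨ hvol hS hSΨ hHm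

/-! ### The extension operator as a tempered distribution -/

theorem hypPt_snd (s : ℝ) (p : ℝ × ℝ) : (hypPt s p).snd =
    (Real.exp p.1 + (s ^ 2 + p.2 ^ 2) * Real.exp (-p.1)) / 2 := rfl

theorem hypPt_injective (s : ℝ) : Function.Injective (hypPt s) := by
  intro p q h
  have h1 : conePt s p = conePt s q := coneCoord.symm.injective h
  have h2 : Real.exp p.1 = Real.exp q.1 := congrArg Prod.fst h1
  have h3 : p.2 = q.2 := congrArg (fun x => x.2.1) h1
  exact Prod.ext (Real.exp_injective h2) h3

theorem measurableEmbedding_hypPt (s : ℝ) : MeasurableEmbedding (hypPt s) :=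
  (continuous_hypPt s).measurableEmbedding (hypPt_injective s)

theorem hypPt_snd_sq (s : ℝ) (p : ℝ × ℝ) :
    (hypPt s p).snd ^ 2 = s ^ 2 + ‖(hypPt s p).fst‖ ^ 2 := by
  have hE : Real.exp p.1 * Real.exp (-p.1) = 1 := by rw [← Real.exp_add]; simp
  rw [hypPt_snd, norm_sq_euclidean_two, hypPt, coneCoord_symm_fst, conePt]
  simp only [Matrix.cons_val_zero, Matrix.cons_val_one]
  linear_combination (s ^ 2 + p.2 ^ 2) * hE

theorem hypPt_snd_pos {s : ℝ} (hs : 0 < s) (p : ℝ × ℝ) : 0 < (hypPt s p).snd := by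
  rw [hypPt_snd]
  positivity

theorem le_hypPt_snd {s : ℝ} (hs : 0 < s) (p : ℝ × ℝ) : s ≤ (hypPt s p).snd := by
  have h1 := hypPt_snd_sq s p
  have h2 := hypPt_snd_pos hs p
  nlinarith [sq_nonneg ‖(hypPt s p).fst‖]

theorem hypPt_snd_le_norm (s : ℝ) (p : ℝ × ℝ) : (hypPt s p).snd ≤ ‖hypPt s p‖ := by
  have h := WithLp.prod_norm_sq_eq_of_L2 (hypPt s p)
  have h2 : ‖(hypPt s p).snd‖ ≤ ‖hypPt s p‖ := by
    refine le_of_sq_le_sq ?_ (norm_nonneg _)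
    nlinarith [sq_nonneg ‖(hypPt s p).fst‖]
  exact (Real.le_norm_self _).trans h2

theorem one_add_norm_le_mul_hypPt_snd {s : ℝ} (hs : 0 < s) : ∃ B : ℝ, 0 < B ∧
    ∀ p : ℝ × ℝ, 1 + ‖p‖ ≤ B * (hypPt s p).snd := by
  refine ⟨1 / s + (2 + 2 / s ^ 2 + 1), by positivity, fun p => ?_⟩
  have hτ := le_hypPt_snd hs p
  have hτ0 := hypPt_snd_pos hs p
  have h1 : 1 ≤ 1 / s * (hypPt s p).snd := by
    rw [one_div_mul_eq_div, one_le_div hs]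
    exact hτ
  have e1 := Real.exp_pos p.1
  have e2 := Real.exp_pos (-p.1)
  have hE : Real.exp p.1 * Real.exp (-p.1) = 1 := by rw [← Real.exp_add]; simp
  have h2 : |p.2| ≤ (hypPt s p).snd := by
    have h3 := hypPt_snd_sq s p
    rw [norm_sq_euclidean_two] at h3
    have h4 : (hypPt s p).fst 1 = p.2 := rfl
    rw [h4] at h3
    refine abs_le_of_sq_le_sq ?_ hτ0.le
    nlinarith [sq_nonneg ((hypPt s p).fst 0), sq_nonneg s]
  have h5 : |p.1| ≤ (2 + 2 / s ^ 2) * (hypPt s p).snd := by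
    have h6 : |p.1| ≤ Real.exp p.1 + Real.exp (-p.1) := by
      rcases abs_cases p.1 with ⟨h, _⟩ | ⟨h, _⟩ <;> rw [h]
      · linarith [Real.add_one_le_exp p.1]
      · linarith [Real.add_one_le_exp (-p.1)]
    have h7 : Real.exp p.1 ≤ 2 * (hypPt s p).snd := by
      rw [hypPt_snd]
      have : 0 ≤ (s ^ 2 + p.2 ^ 2) * Real.exp (-p.1) := by positivity
      linarith
    have h8 : Real.exp (-p.1) ≤ 2 / s ^ 2 * (hypPt s p).snd := by
      rw [hypPt_snd, div_mul_eq_mul_div, le_div_iff₀ (by positivity)]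
      have : 0 ≤ p.2 ^ 2 * Real.exp (-p.1) := by positivity
      nlinarith
    linarith
  have h9 : ‖p‖ ≤ (2 + 2 / s ^ 2 + 1) * (hypPt s p).snd := by
    rw [Prod.norm_def]
    refine max_le ?_ ?_
    · rw [Real.norm_eq_abs]
      linarith
    · rw [Real.norm_eq_abs]
      have : 0 ≤ (2 + 2 / s ^ 2) * (hypPt s p).snd := by positivity
      linarith
  linarith

/-- The height $\tau$ dominates $1+|p|$, and $(1+|p|)^{-3}$ is integrable on the parameter plane
since $3>2$. Square integrability follows because `h` is also bounded, as $\tau\ge s$. -/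
theorem integrable_and_memLp_two_of_decay {s : ℝ} (hs : 0 < s) {h : ℝ × ℝ → ℂ}
    (hm : AEStronglyMeasurable h volume) {C : ℝ}
    (hC : ∀ p, (hypPt s p).snd ^ 3 * ‖h p‖ ≤ C) : Integrable h ∧ MemLp h 2 := by
  obtain ⟨B, hB, hBp⟩ := one_add_norm_le_mul_hypPt_snd hs
  have : (volume : Measure (ℝ × ℝ)).IsAddHaarMeasure := Measure.prod.instIsAddHaarMeasure _ _
  have hint : Integrable (fun p : ℝ × ℝ => (B ^ 3 * C) * (1 + ‖p‖) ^ (-(3 : ℝ))) := by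
    refine (integrable_one_add_norm ?_).const_mul _
    simp
    norm_num
  have hi : Integrable h := by
    refine hint.mono' hm (Eventually.of_forall fun p => ?_)
    have h1 : 0 < 1 + ‖p‖ := by positivity
    rw [Real.rpow_neg h1.le, ← div_eq_mul_inv, le_div_iff₀ (by positivity)]
    rw [show (3 : ℝ) = ((3 : ℕ) : ℝ) by norm_num, Real.rpow_natCast]
    calc ‖h p‖ * (1 + ‖p‖) ^ 3 ≤ ‖h p‖ * (B * (hypPt s p).snd) ^ 3 := by
          gcongr
          exact hBp p
      _ = B ^ 3 * ((hypPt s p).snd ^ 3 * ‖h p‖) := by ring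
      _ ≤ B ^ 3 * C := by gcongr; exact hC p
  refine ⟨hi, (memLp_two_iff_integrable_sq_norm hm).2 ?_⟩
  have hbd : ∀ p, ‖‖h p‖‖ ≤ C / s ^ 3 := fun p => by
    rw [norm_norm, le_div_iff₀ (by positivity)]
    calc ‖h p‖ * s ^ 3 ≤ ‖h p‖ * (hypPt s p).snd ^ 3 := by
          gcongr
          exact le_hypPt_snd hs p
      _ ≤ C := by rw [mul_comm]; exact hC p
  have := hi.norm.bdd_mul hm.norm (Eventually.of_forall hbd)
  simpa only [sq] using this

theorem memLp_fourierHat_hypPt {s : ℝ} (hs : 0 < s) (φ : 𝓢(SpaceTime 2, ℂ)) :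
    MemLp (fun p => fourierHat 2 φ (hypPt s p)) 2 volume := by
  obtain ⟨ψ, hψ⟩ : ∃ ψ : 𝓢(SpaceTime 2, ℂ), ∀ ζ, fourierHat 2 φ ζ = ψ ((2 * Real.pi)⁻¹ • ζ) :=
    ⟨FourierTransform.fourier φ, fun ζ => fourierHat_eq_fourier 2 φ ζ⟩
  obtain ⟨C, -, hC⟩ := ψ.decay 3 0
  simp only [norm_iteratedFDeriv_zero] at hC
  simp only [hψ]
  refine (integrable_and_memLp_two_of_decay hs (C := (2 * Real.pi) ^ 3 * C) ?_ fun p => ?_).2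
  · have h3 : Continuous fun p => (2 * Real.pi)⁻¹ • hypPt s p :=
      Continuous.const_smul (continuous_hypPt s) (2 * Real.pi)⁻¹
    exact (ψ.continuous.comp h3).aestronglyMeasurable
  · have h4 := hC ((2 * Real.pi)⁻¹ • hypPt s p)
    rw [norm_smul, mul_pow, Real.norm_of_nonneg (by positivity)] at h4
    have hb := norm_nonneg (ψ ((2 * Real.pi)⁻¹ • hypPt s p))
    generalize ‖ψ ((2 * Real.pi)⁻¹ • hypPt s p)‖ = b at h4 hb ⊢
    have h5 : (hypPt s p).snd ^ 3 ≤ ‖hypPt s p‖ ^ 3 :=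
      pow_le_pow_left₀ (hypPt_snd_pos hs p).le (hypPt_snd_le_norm s p) 3
    have hπ : (0 : ℝ) < (2 * Real.pi) ^ 3 := by positivity
    rw [inv_pow, mul_assoc, inv_mul_le_iff₀ hπ] at h4
    exact (mul_le_mul_of_nonneg_right h5 hb).trans h4

theorem isExtension_iff {s : ℝ} (hs : 0 < s) (f g : SpaceTime 2 → ℂ) :
    IsExtension 2 s f g ↔ ∀ φ : 𝓢(SpaceTime 2, ℂ), ∫ z, g z * φ z =
      ∫ p, f (hypPt s p) * fourierHat 2 φ (hypPt s p) := by
  unfold IsExtension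
  simp only [sigma_eq_map hs, (measurableEmbedding_hypPt s).integral_map]

theorem memLp_sigma_iff {s : ℝ} (hs : 0 < s) (f : SpaceTime 2 → ℂ) (q : ℝ≥0∞) :
    MemLp f q (sigma 2 s) ↔ MemLp (f ∘ hypPt s) q volume := by
  rw [sigma_eq_map hs, (measurableEmbedding_hypPt s).memLp_map_measure_iff]

theorem eLpNorm_sigma {s : ℝ} (hs : 0 < s) (f : SpaceTime 2 → ℂ) (q : ℝ≥0∞) :
    eLpNorm f q (sigma 2 s) = eLpNorm (f ∘ hypPt s) q volume := by
  rw [sigma_eq_map hs, (measurableEmbedding_hypPt s).eLpNorm_map_measure]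

theorem integral_extFn_mul {s : ℝ} {h : ℝ × ℝ → ℂ} (hi : Integrable h)
    (φ : 𝓢(SpaceTime 2, ℂ)) :
    ∫ z, extFn s h z * φ z = ∫ p, h p * fourierHat 2 φ (hypPt s p) := by
  have hcont : Continuous fun x : SpaceTime 2 × (ℝ × ℝ) =>
      Complex.exp (-(Complex.I * (inner ℝ (hypPt s x.2) x.1 : ℝ))) := by
    have := continuous_hypPt s
    fun_prop
  have hprod : Integrable (fun x : SpaceTime 2 × (ℝ × ℝ) =>
      Complex.exp (-(Complex.I * (inner ℝ (hypPt s x.2) x.1 : ℝ))) * (φ x.1 * h x.2))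
      (volume.prod volume) := by
    refine ((φ.integrable (μ := volume)).mul_prod hi).bdd_mul (c := 1)
      hcont.aestronglyMeasurable (Eventually.of_forall fun y => ?_)
    rw [norm_cexp_neg_I_mul]
  calc ∫ z, extFn s h z * φ z = ∫ z, ∫ p,
        Complex.exp (-(Complex.I * (inner ℝ (hypPt s p) z : ℝ))) * (φ z * h p) := by
        refine integral_congr_ae (Eventually.of_forall fun z => ?_)
        simp only [extFn]
        rw [← integral_mul_const]
        congr 1
        ext p
        ring
    _ = ∫ p, ∫ z, Complex.exp (-(Complex.I * (inner ℝ (hypPt s p) z : ℝ))) * (φ z * h p) :=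
        integral_integral_swap hprod
    _ = _ := by
        refine integral_congr_ae (Eventually.of_forall fun p => ?_)
        simp only [fourierHat]
        rw [← integral_const_mul]
        congr 1
        ext z
        rw [real_inner_comm]
        ring

theorem measurable_extFn {s : ℝ} {h : ℝ × ℝ → ℂ} (hm : Measurable h) :
    Measurable (extFn s h) := by
  have hcont : Continuous fun x : SpaceTime 2 × (ℝ × ℝ) =>
      Complex.exp (-(Complex.I * (inner ℝ (hypPt s x.2) x.1 : ℝ))) := by
    have := continuous_hypPt s
    fun_prop
  have h1 : StronglyMeasurable fun x : SpaceTime 2 × (ℝ × ℝ) =>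
      Complex.exp (-(Complex.I * (inner ℝ (hypPt s x.2) x.1 : ℝ))) * h x.2 :=
    (hcont.measurable.mul (hm.comp measurable_snd)).stronglyMeasurable
  exact h1.integral_prod_right'.measurable

theorem extFn_sub {s : ℝ} {h h' : ℝ × ℝ → ℂ} (hi : Integrable h) (hi' : Integrable h')
    (x : SpaceTime 2) : extFn s (h - h') x = extFn s h x - extFn s h' x := by
  have hcont : Continuous fun p : ℝ × ℝ =>
      Complex.exp (-(Complex.I * (inner ℝ (hypPt s p) x : ℝ))) := by
    have := continuous_hypPt s
    fun_prop
  have hb : ∀ {k : ℝ × ℝ → ℂ}, Integrable k → Integrable fun p : ℝ × ℝ =>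
      Complex.exp (-(Complex.I * (inner ℝ (hypPt s p) x : ℝ))) * k p := fun hk =>
    hk.bdd_mul (c := 1) hcont.aestronglyMeasurable
      (Eventually.of_forall fun y => by rw [norm_cexp_neg_I_mul])
  simp only [extFn]
  rw [← integral_sub (hb hi) (hb hi')]
  simp only [Pi.sub_apply, mul_sub]

theorem eLpNorm_four_pow {α : Type*} [MeasurableSpace α] {μ : Measure α} (g : α → ℂ) :
    eLpNorm g 4 μ ^ 4 = ∫⁻ x, ‖g x‖ₑ ^ 4 ∂μ := by
  have := eLpNorm_nnreal_pow_eq_lintegral (f := g) (p := 4) (μ := μ) four_ne_zero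
  rw [show ((4 : NNReal) : ℝ≥0∞) = 4 by simp,
    show ((4 : NNReal) : ℝ) = ((4 : ℕ) : ℝ) by simp] at this
  simpa only [ENNReal.rpow_natCast] using this

theorem eLpNorm_two_pow {α : Type*} [MeasurableSpace α] {μ : Measure α} (g : α → ℂ) :
    eLpNorm g 2 μ ^ 2 = ∫⁻ x, ‖g x‖ₑ ^ 2 ∂μ := by
  have := eLpNorm_nnreal_pow_eq_lintegral (f := g) (p := 2) (μ := μ) two_ne_zero
  simpa using this

theorem pairEnergy_mono {s : ℝ} {h h' : ℝ × ℝ → ℂ} (hle : ∀ p, ‖h p‖ₑ ≤ ‖h' p‖ₑ) :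
    pairEnergy s h ≤ pairEnergy s h' := by
  refine lintegral_mono fun y => ?_
  gcongr <;> exact hle _

theorem pairEnergy_congr_ae {s : ℝ} {h h' : ℝ × ℝ → ℂ} (hh : h =ᵐ[volume] h') :
    pairEnergy s h = pairEnergy s h' := by
  refine lintegral_congr_ae ?_
  have h1 : ∀ᵐ y : (ℝ × ℝ) × (ℝ × ℝ), h y.1 = h' y.1 :=
    Measure.quasiMeasurePreserving_fst.ae hh
  have h2 : ∀ᵐ y : (ℝ × ℝ) × (ℝ × ℝ), h y.2 = h' y.2 :=
    Measure.quasiMeasurePreserving_snd.ae hh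
  filter_upwards [h1, h2] with y e1 e2
  rw [e1, e2]

theorem pairEnergy_le {s : ℝ} (hs : 0 < s) {h : ℝ × ℝ → ℂ} (hm : Measurable h) :
    pairEnergy s h ≤ ENNReal.ofReal (1 / (2 * s)) * eLpNorm h 2 volume ^ 4 := by
  rw [show eLpNorm h 2 volume ^ 4 = (eLpNorm h 2 volume ^ 2) ^ 2 by ring, eLpNorm_two_pow,
    ← lintegral_enorm_sq_mul hm, ← lintegral_const_mul _ (by fun_prop)]
  refine lintegral_mono fun y => ?_
  rw [enorm_mul, mul_pow, mul_comm]
  gcongr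
  exact pairKernel_le hs y

theorem tendsto_eLpNorm_indicator_ball_sub {h : ℝ × ℝ → ℂ} (hm : Measurable h)
    (h2 : MemLp h 2) :
    Tendsto (fun k : ℕ => eLpNorm ((Metric.ball (0 : ℝ × ℝ) k).indicator h - h) 2 volume)
      atTop (𝓝 0) := by
  have hlim : Tendsto (fun k : ℕ => ∫⁻ p, ‖((Metric.ball (0 : ℝ × ℝ) k).indicator h - h) p‖ₑ ^ 2)
      atTop (𝓝 (∫⁻ _ : ℝ × ℝ, 0)) := by
    refine tendsto_lintegral_of_dominated_convergence (fun p => ‖h p‖ₑ ^ 2) (fun k => ?_)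
      (fun k => Eventually.of_forall fun p => ?_) (lintegral_enorm_sq_lt_top h2).ne
      (Eventually.of_forall fun p => ?_)
    · have := (hm.indicator (Metric.isOpen_ball (x := (0 : ℝ × ℝ)) (ε := k)).measurableSet).sub hm
      exact this.enorm.pow_const 2
    · by_cases hp : p ∈ Metric.ball (0 : ℝ × ℝ) k <;> simp [hp]
    · refine tendsto_const_nhds.congr' ?_
      obtain ⟨N, hN⟩ := exists_nat_gt ‖p‖
      filter_upwards [eventually_ge_atTop N] with k hk
      have : p ∈ Metric.ball (0 : ℝ × ℝ) k := by
        rw [mem_ball_zero_iff]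
        exact hN.trans_le (by exact_mod_cast hk)
      simp [this]
  rw [lintegral_zero] at hlim
  have h3 := (ENNReal.continuous_rpow_const (y := 1 / 2)).continuousAt.tendsto.comp hlim
  rw [ENNReal.zero_rpow_of_pos (by norm_num)] at h3
  refine h3.congr fun k => ?_
  rw [Function.comp_apply, ← eLpNorm_two_pow, ← ENNReal.rpow_natCast, ← ENNReal.rpow_mul]
  simp

theorem tendsto_integral_mul_of_tendsto_Lp {α : Type*} [MeasurableSpace α] {μ : Measure α}
    {p q : ℝ≥0∞} [Fact (1 ≤ p)] [Fact (1 ≤ q)] [p.HolderConjugate q] {f : ℕ → Lp ℂ p μ}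
    {f₀ : Lp ℂ p μ} (hf : Tendsto f atTop (𝓝 f₀)) {ψ : α → ℂ} (hψ : MemLp ψ q μ) :
    Tendsto (fun k => ∫ x, f k x * ψ x ∂μ) atTop (𝓝 (∫ x, f₀ x * ψ x ∂μ)) := by
  have h1 : Continuous fun u : Lp ℂ p μ =>
      (ContinuousLinearMap.mul ℂ ℂ).lpPairing μ p q u (hψ.toLp ψ) := by fun_prop
  have h2 : ∀ u : Lp ℂ p μ, (ContinuousLinearMap.mul ℂ ℂ).lpPairing μ p q u (hψ.toLp ψ) =
      ∫ x, u x * ψ x ∂μ := fun u => by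
    rw [ContinuousLinearMap.lpPairing_eq_integral]
    refine integral_congr_ae ?_
    filter_upwards [hψ.coeFn_toLp] with x hx
    rw [hx, ContinuousLinearMap.mul_apply']
  simpa only [h2, Function.comp_def] using (h1.tendsto f₀).comp hf

/-- Truncations of `h` to balls are integrable and converge in $L^2$. The quartic bound makes their
extensions Cauchy in $L^4$, and pairing with Schwartz functions identifies the limit. -/
theorem exists_extension {s : ℝ} (hs : 0 < s) {C : ℝ≥0∞} (hC : C ≠ ∞)
    (hbound : ∀ h : ℝ × ℝ → ℂ, Measurable h → Integrable h → MemLp h 2 →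
      ∫⁻ x, ‖extFn s h x‖ₑ ^ 4 ≤ C * pairEnergy s h)
    {h : ℝ × ℝ → ℂ} (hm : Measurable h) (h2 : MemLp h 2) :
    ∃ g : SpaceTime 2 → ℂ, MemLp g 4 ∧
      (∀ φ : 𝓢(SpaceTime 2, ℂ), ∫ z, g z * φ z = ∫ p, h p * fourierHat 2 φ (hypPt s p)) ∧
      eLpNorm g 4 volume ^ 4 ≤ C * pairEnergy s h := by
  set hk : ℕ → ℝ × ℝ → ℂ := fun k => (Metric.ball (0 : ℝ × ℝ) k).indicator h with hk_def
  have hball : ∀ k : ℕ, MeasurableSet (Metric.ball (0 : ℝ × ℝ) k) := fun k =>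
    Metric.isOpen_ball.measurableSet
  have hkm : ∀ k, Measurable (hk k) := fun k => hm.indicator (hball k)
  have hk2 : ∀ k, MemLp (hk k) 2 := fun k => h2.indicator (hball k)
  have hk1 : ∀ k, Integrable (hk k) := fun k => by
    rw [integrable_indicator_iff (hball k)]
    have : IsFiniteMeasure (volume.restrict (Metric.ball (0 : ℝ × ℝ) k)) :=
      ⟨by rw [Measure.restrict_apply_univ]; exact measure_ball_lt_top⟩
    exact (h2.restrict _).integrable one_le_two
  have hg4 : ∀ u : ℝ × ℝ → ℂ, Measurable u → Integrable u → MemLp u 2 →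
      MemLp (extFn s u) 4 := fun u um u1 u2 => by
    refine ⟨(measurable_extFn um).aestronglyMeasurable, ?_⟩
    have h3 : eLpNorm (extFn s u) 4 volume ^ 4 < ∞ := by
      rw [eLpNorm_four_pow]
      refine (hbound u um u1 u2).trans_lt (ENNReal.mul_lt_top hC.lt_top ?_)
      exact (pairEnergy_le hs um).trans_lt
        (ENNReal.mul_lt_top ENNReal.ofReal_lt_top (ENNReal.pow_lt_top u2.2))
    rw [lt_top_iff_ne_top]
    intro h4
    simp [h4] at h3
  set gk : ℕ → SpaceTime 2 → ℂ := fun k => extFn s (hk k) with gk_def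
  have gk4 : ∀ k, MemLp (gk k) 4 := fun k => hg4 _ (hkm k) (hk1 k) (hk2 k)
  set D : ℝ≥0∞ := C * ENNReal.ofReal (1 / (2 * s)) with hD
  have hDtop : D ≠ ∞ := ENNReal.mul_ne_top hC ENNReal.ofReal_ne_top
  set B : ℝ≥0∞ := D ^ (1 / 4 : ℝ) with hB
  have hBtop : B ≠ ∞ := ENNReal.rpow_ne_top_of_nonneg (by norm_num) hDtop
  have hB4 : B ^ 4 = D := by
    rw [hB, ← ENNReal.rpow_natCast, ← ENNReal.rpow_mul]
    simp
  -- The quartic bound, applied to a difference by linearity, is a Lipschitz estimate from $L^2$ to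
  -- $L^4$.
  have hdiff : ∀ k l, eLpNorm (gk k - gk l) 4 volume ≤ B * eLpNorm (hk k - hk l) 2 volume := by
    intro k l
    have e1 : gk k - gk l = extFn s (hk k - hk l) := by
      ext x
      rw [extFn_sub (hk1 k) (hk1 l)]
      rfl
    have hmd : Measurable (hk k - hk l) := (hkm k).sub (hkm l)
    refine (ENNReal.pow_le_pow_left_iff four_ne_zero).1 ?_
    rw [e1, eLpNorm_four_pow, mul_pow, hB4, hD, mul_assoc]
    exact (hbound _ hmd ((hk1 k).sub (hk1 l)) ((hk2 k).sub (hk2 l))).trans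
      (mul_le_mul_right (pairEnergy_le hs hmd) _)
  have : Fact ((1 : ℝ≥0∞) ≤ 4) := ⟨by norm_num⟩
  have hHlim : Tendsto (fun k => (hk2 k).toLp (hk k)) atTop (𝓝 (h2.toLp h)) :=
    (Lp.tendsto_Lp_iff_tendsto_eLpNorm'' hk hk2 h h2).2 (tendsto_eLpNorm_indicator_ball_sub hm h2)
  have hGcauchy : CauchySeq fun k => (gk4 k).toLp (gk k) := by
    rw [EMetric.cauchySeq_iff]
    intro ε hε
    -- The shift by 1 avoids dividing by a possibly vanishing `B`.
    have hε' : 0 < ε / (B + 1) := ENNReal.div_pos hε.ne' (by simp [hBtop])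
    obtain ⟨N, hN⟩ := EMetric.cauchySeq_iff.1 hHlim.cauchySeq _ hε'
    refine ⟨N, fun k hk' l hl' => ?_⟩
    have h3 := hN k hk' l hl'
    rw [Lp.edist_toLp_toLp] at h3 ⊢
    calc eLpNorm (gk k - gk l) 4 volume ≤ B * eLpNorm (hk k - hk l) 2 volume := hdiff k l
      _ ≤ (B + 1) * eLpNorm (hk k - hk l) 2 volume := by gcongr; exact le_self_add
      _ < ε := by
        rw [mul_comm]
        exact (ENNReal.lt_div_iff_mul_lt (by simp) (by simp [hBtop])).1 h3
  obtain ⟨G, hG⟩ := cauchySeq_tendsto_of_complete hGcauchy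
  refine ⟨G, Lp.memLp G, fun φ => ?_, ?_⟩
  · have : Fact ((1 : ℝ≥0∞) ≤ (1 - 4⁻¹)⁻¹) := ⟨by simp⟩
    have : ENNReal.HolderConjugate 4 (1 - 4⁻¹)⁻¹ :=
      ENNReal.HolderConjugate.inv_one_sub_inv' (by norm_num)
    have l1 := tendsto_integral_mul_of_tendsto_Lp hG (φ.memLp (1 - 4⁻¹)⁻¹ volume)
    have l2 := tendsto_integral_mul_of_tendsto_Lp hHlim (memLp_fourierHat_hypPt hs φ)
    have e2 : ∫ p, h2.toLp h p * fourierHat 2 φ (hypPt s p) =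
        ∫ p, h p * fourierHat 2 φ (hypPt s p) := by
      refine integral_congr_ae ?_
      filter_upwards [h2.coeFn_toLp] with p hp
      rw [hp]
    rw [← e2]
    refine tendsto_nhds_unique l1 (l2.congr fun k => ?_)
    calc _ = ∫ p, hk k p * fourierHat 2 φ (hypPt s p) := by
          refine integral_congr_ae ?_
          filter_upwards [(hk2 k).coeFn_toLp] with p hp
          rw [hp]
      _ = ∫ z, gk k z * φ z := (integral_extFn_mul (hk1 k) φ).symm
      _ = _ := by
          refine integral_congr_ae ?_
          filter_upwards [(gk4 k).coeFn_toLp] with p hp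
          rw [hp]
  · have l1 : Tendsto (fun k => ‖(gk4 k).toLp (gk k)‖ₑ ^ 4) atTop (𝓝 (‖G‖ₑ ^ 4)) :=
      ((ENNReal.continuous_pow 4).tendsto _).comp ((continuous_enorm.tendsto G).comp hG)
    rw [Lp.enorm_def] at l1
    refine le_of_tendsto' l1 fun k => ?_
    rw [Lp.enorm_toLp, eLpNorm_four_pow]
    refine (hbound _ (hkm k) (hk1 k) (hk2 k)).trans ?_
    gcongr
    refine pairEnergy_mono fun p => ?_
    simp only [hk_def]
    by_cases hp : p ∈ Metric.ball (0 : ℝ × ℝ) k <;> simp [hp]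

/-- The extension just built is one competitor in the infimum defining the norm. -/
theorem extensionNorm_pow_four_le {s : ℝ} (hs : 0 < s) {C : ℝ≥0∞} (hC : C ≠ ∞)
    (hbound : ∀ h : ℝ × ℝ → ℂ, Measurable h → Integrable h → MemLp h 2 →
      ∫⁻ x, ‖extFn s h x‖ₑ ^ 4 ≤ C * pairEnergy s h)
    {f : SpaceTime 2 → ℂ} (hf : MemLp f 2 (sigma 2 s)) :
    extensionNorm 2 s 4 f ^ 4 ≤ C * pairEnergy s (f ∘ hypPt s) := by
  have h2 := (memLp_sigma_iff hs f 2).1 hf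
  set h' := h2.aestronglyMeasurable.mk (f ∘ hypPt s) with hh'
  have hae : f ∘ hypPt s =ᵐ[volume] h' := h2.aestronglyMeasurable.ae_eq_mk
  obtain ⟨g, hg4, hgφ, hgn⟩ := exists_extension hs hC hbound
    h2.aestronglyMeasurable.stronglyMeasurable_mk.measurable ((memLp_congr_ae hae).1 h2)
  rw [pairEnergy_congr_ae hae]
  refine le_trans ?_ hgn
  gcongr
  refine iInf_le_of_le g (iInf_le_of_le hg4 (iInf_le_of_le ?_ le_rfl))
  rw [isExtension_iff hs]
  intro φ
  rw [hgφ]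
  refine integral_congr_ae ?_
  filter_upwards [hae] with p hp
  rw [← hh', ← hp, Function.comp_apply]

/-- Every competitor in the infimum equals `extFn` almost everywhere, since Schwartz functions
determine a locally integrable function. -/
theorem extensionNorm_pow_four_ge {s : ℝ} (hs : 0 < s) {f : SpaceTime 2 → ℂ}
    (hm : Measurable (f ∘ hypPt s)) (hi : Integrable (f ∘ hypPt s))
    (h4 : ∫⁻ x, ‖extFn s (f ∘ hypPt s) x‖ₑ ^ 4 ≠ ∞) :
    ∫⁻ x, ‖extFn s (f ∘ hypPt s) x‖ₑ ^ 4 ≤ extensionNorm 2 s 4 f ^ 4 := by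
  have hE4 : MemLp (extFn s (f ∘ hypPt s)) 4 := by
    refine ⟨(measurable_extFn hm).aestronglyMeasurable, ?_⟩
    rw [← eLpNorm_four_pow] at h4
    rw [lt_top_iff_ne_top]
    intro h
    simp [h] at h4
  rw [← eLpNorm_four_pow]
  gcongr
  refine le_iInf fun g => le_iInf fun hg => le_iInf fun hext => ?_
  rw [isExtension_iff hs] at hext
  refine (eLpNorm_congr_ae (ae_eq_of_integral_schwartz_eq (hE4.locallyIntegrable (by norm_num))
    (hg.locallyIntegrable (by norm_num)) fun φ => ?_)).le
  rw [hext, integral_extFn_mul hi]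
  rfl

theorem le_bestConstant_pow_four {s : ℝ} (hs : 0 < s) {C : ℝ≥0∞} (hC : C ≠ ∞)
    (heq : ∀ h : ℝ × ℝ → ℂ, Measurable h → Integrable h → MemLp h 2 →
      (∃ H : SpaceTime 2 → ℂ, Measurable H ∧ ∀ y, h y.1 * h y.2 = H (pairSum s y)) →
      ∫⁻ x, ‖extFn s h x‖ₑ ^ 4 = C * pairEnergy s h)
    {f H : SpaceTime 2 → ℂ} (hm : Measurable (f ∘ hypPt s)) (hi : Integrable (f ∘ hypPt s))
    (h2 : MemLp (f ∘ hypPt s) 2) (h0 : ∫⁻ p, ‖f (hypPt s p)‖ₑ ^ 2 ≠ 0) (hHm : Measurable H)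
    (hH : ∀ y : (ℝ × ℝ) × (ℝ × ℝ), f (hypPt s y.1) * f (hypPt s y.2) = H (pairSum s y)) :
    C * pairEnergy s (f ∘ hypPt s) ≤
      bestConstant 2 s 4 ^ 4 * (∫⁻ p, ‖f (hypPt s p)‖ₑ ^ 2) ^ 2 := by
  have e1 := heq _ hm hi h2 ⟨H, hHm, hH⟩
  have hN : eLpNorm f 2 (sigma 2 s) ^ 2 = ∫⁻ p, ‖f (hypPt s p)‖ₑ ^ 2 := by
    rw [eLpNorm_sigma hs, eLpNorm_two_pow]
    rfl
  have hN0 : eLpNorm f 2 (sigma 2 s) ≠ 0 := by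
    intro h
    rw [h] at hN
    exact h0 (by rw [← hN]; simp)
  have hfin : C * pairEnergy s (f ∘ hypPt s) ≠ ∞ :=
    ENNReal.mul_ne_top hC ((pairEnergy_le hs hm).trans_lt
        (ENNReal.mul_lt_top ENNReal.ofReal_lt_top (ENNReal.pow_lt_top h2.2))).ne
  have hf2 : MemLp f 2 (sigma 2 s) := (memLp_sigma_iff hs f 2).2 h2
  have h3 : extensionNorm 2 s 4 f / eLpNorm f 2 (sigma 2 s) ≤ bestConstant 2 s 4 :=
    le_iSup_of_le f (le_iSup_of_le hf2 (le_iSup_of_le hN0 le_rfl))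
  rw [ENNReal.div_le_iff hN0 hf2.2.ne] at h3
  calc C * pairEnergy s (f ∘ hypPt s) ≤ extensionNorm 2 s 4 f ^ 4 := by
        rw [← e1]
        exact extensionNorm_pow_four_ge hs hm hi (by rw [e1]; exact hfin)
    _ ≤ (bestConstant 2 s 4 * eLpNorm f 2 (sigma 2 s)) ^ 4 := by gcongr
    _ = bestConstant 2 s 4 ^ 4 * (eLpNorm f 2 (sigma 2 s) ^ 2) ^ 2 := by ring
    _ = _ := by rw [hN]

/-! ### Sharpness of the constant by exponentials -/

theorem coneSq_conePt_add_le (s : ℝ) (p p' : ℝ × ℝ) :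
    coneSq (conePt s p + conePt s p') ≤ ((hypPt s p).snd + (hypPt s p').snd) ^ 2 := by
  simp only [coneSq, conePt, hypPt_snd, Prod.fst_add, Prod.snd_add]
  have := sq_nonneg (Real.exp p.1 + Real.exp p'.1 - ((s ^ 2 + p.2 ^ 2) * Real.exp (-p.1) +
    (s ^ 2 + p'.2 ^ 2) * Real.exp (-p'.1)))
  have := sq_nonneg (p.2 + p'.2)
  nlinarith

theorem le_pairKernel {s b : ℝ} (hs : 0 < s) {y : (ℝ × ℝ) × (ℝ × ℝ)}
    (h1 : (hypPt s y.1).snd < b) (h2 : (hypPt s y.2).snd < b) :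
    ENNReal.ofReal (1 / (2 * b)) ≤ pairKernel s y := by
  have h3 := coneSq_conePt_add_le s y.1 y.2
  have h4 := conePt_add_sq_bound (s := s) y.1 y.2
  have h5 := hypPt_snd_pos hs y.1
  have h6 := hypPt_snd_pos hs y.2
  have h7 : 0 < coneSq (conePt s y.1 + conePt s y.2) := lt_of_lt_of_le (by positivity) h4
  refine ENNReal.ofReal_le_ofReal (one_div_le_one_div_of_le (Real.sqrt_pos.2 h7) ?_)
  refine Real.sqrt_le_iff.2 ⟨by linarith, h3.trans ?_⟩
  gcongr
  linarith

theorem measurableSet_snd_lt (s b : ℝ) : MeasurableSet {p : ℝ × ℝ | (hypPt s p).snd < b} := by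
  have := continuous_hypPt s
  exact (isOpen_lt (by fun_prop) continuous_const).measurableSet

theorem le_pairEnergy_of_snd_lt {s b : ℝ} (hs : 0 < s) {h : ℝ × ℝ → ℂ} (hm : Measurable h) :
    ENNReal.ofReal (1 / (2 * b)) * (∫⁻ p in {p | (hypPt s p).snd < b}, ‖h p‖ₑ ^ 2) ^ 2 ≤
      pairEnergy s h := by
  set S := {p : ℝ × ℝ | (hypPt s p).snd < b} with hS
  have hSm : MeasurableSet S := measurableSet_snd_lt s b
  have e1 : ∫⁻ p in S, ‖h p‖ₑ ^ 2 = ∫⁻ p, ‖S.indicator h p‖ₑ ^ 2 := by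
    rw [← lintegral_indicator hSm]
    refine lintegral_congr fun p => ?_
    by_cases hp : p ∈ S <;> simp [hp]
  have hmS : Measurable (S.indicator h) := hm.indicator hSm
  rw [e1, ← lintegral_enorm_sq_mul hmS, ← lintegral_const_mul _ (by fun_prop)]
  refine lintegral_mono fun y => ?_
  by_cases h1 : y.1 ∈ S
  · by_cases h2 : y.2 ∈ S
    · simp only [Set.indicator_of_mem h1, Set.indicator_of_mem h2]
      rw [enorm_mul, mul_pow, mul_comm]
      gcongr
      exact le_pairKernel hs h1 h2
    · simp [h2]
  · simp [h1]

/-- The exponential `e^{-a τ}`. -/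
noncomputable def expProfile (a : ℝ) (z : SpaceTime 2) : ℂ := (Real.exp (-(a * z.snd)) : ℝ)

theorem continuous_expProfile (a : ℝ) : Continuous (expProfile a) := by
  unfold expProfile
  fun_prop

theorem enorm_expProfile_sq (a : ℝ) (z : SpaceTime 2) :
    ‖expProfile a z‖ₑ ^ 2 = ENNReal.ofReal (Real.exp (-(2 * a * z.snd))) := by
  rw [expProfile, ← ofReal_norm, Complex.norm_real,
    Real.norm_of_nonneg (Real.exp_pos _).le, ← ENNReal.ofReal_pow (Real.exp_pos _).le,
    ← Real.exp_nat_mul]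
  congr 2
  push_cast
  ring

theorem integrable_and_memLp_expProfile {s a : ℝ} (hs : 0 < s) (ha : 0 < a) :
    Integrable (expProfile a ∘ hypPt s) ∧ MemLp (expProfile a ∘ hypPt s) 2 := by
  refine integrable_and_memLp_two_of_decay hs (C := 6 / a ^ 3)
    ((continuous_expProfile a).comp (continuous_hypPt s)).aestronglyMeasurable fun p => ?_
  have h1 := hypPt_snd_pos hs p
  have h2 := Real.pow_div_factorial_le_exp (a * (hypPt s p).snd) (by positivity) 3
  rw [Function.comp_apply, expProfile, Complex.norm_real, Real.norm_of_nonneg (Real.exp_pos _).le,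
    Real.exp_neg, ← div_eq_mul_inv, div_le_div_iff₀ (Real.exp_pos _) (by positivity)]
  rw [show ((Nat.factorial 3 : ℕ) : ℝ) = 6 by norm_num [Nat.factorial],
    div_le_iff₀ (by norm_num)] at h2
  calc _ = (a * (hypPt s p).snd) ^ 3 := by ring
    _ ≤ _ := by rw [mul_comm 6]; exact h2

theorem hypPt_log_snd {s : ℝ} (hs : 0 < s) : (hypPt s (Real.log s, 0)).snd = s := by
  rw [hypPt_snd]
  simp only [Real.exp_neg, Real.exp_log hs]
  field_simp
  ring

/-- The mass above height $s+\delta$ is compared with the mass below $s+\delta/2$; the gap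
$\delta/2$ in the exponent wins as $a\to\infty$. -/
theorem exists_tail_expProfile_le {s δ : ℝ} (hs : 0 < s) (hδ : 0 < δ) {ε : ℝ≥0∞} (hε : ε ≠ 0) :
    ∃ a : ℝ, 0 < a ∧ ∫⁻ p in {p | (hypPt s p).snd < s + δ}ᶜ, ‖expProfile a (hypPt s p)‖ₑ ^ 2 ≤
      ε * ∫⁻ p, ‖expProfile a (hypPt s p)‖ₑ ^ 2 := by
  set N₁ := ∫⁻ p, ‖expProfile 1 (hypPt s p)‖ₑ ^ 2 with hN₁
  have hN₁' : N₁ ≠ ∞ :=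
    (lintegral_enorm_sq_lt_top (integrable_and_memLp_expProfile hs one_pos).2).ne
  set S := {p : ℝ × ℝ | (hypPt s p).snd < s + δ / 2} with hS
  have hSm : MeasurableSet S := measurableSet_snd_lt s _
  set m := volume S with hm
  have hm0 : m ≠ 0 := by
    have : (volume : Measure (ℝ × ℝ)).IsAddHaarMeasure := Measure.prod.instIsAddHaarMeasure _ _
    have hopen : IsOpen S := by
      have := continuous_hypPt s
      exact isOpen_lt (by fun_prop) continuous_const
    refine (hopen.measure_pos volume ⟨(Real.log s, 0), ?_⟩).ne'
    rw [hS, Set.mem_ofPred_eq, hypPt_log_snd hs]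
    linarith
  -- Part of the decay is reserved for integrability: $e^{-2a\tau}\le
  -- e^{-2(a-1)(s+\delta)}e^{-2\tau}$ on the tail.
  have hT : ∀ a : ℝ, 1 ≤ a → ∫⁻ p in {p | (hypPt s p).snd < s + δ}ᶜ,
      ‖expProfile a (hypPt s p)‖ₑ ^ 2 ≤
        ENNReal.ofReal (Real.exp (-(2 * (a - 1) * (s + δ)))) * N₁ := fun a ha => by
    rw [hN₁, ← lintegral_const_mul' _ _ ENNReal.ofReal_ne_top]
    refine le_trans ?_ (setLIntegral_le_lintegral {p | (hypPt s p).snd < s + δ}ᶜ _)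
    refine setLIntegral_mono' (measurableSet_snd_lt s _).compl fun p hp => ?_
    have hp' : s + δ ≤ (hypPt s p).snd := by simpa using hp
    rw [enorm_expProfile_sq, enorm_expProfile_sq, ← ENNReal.ofReal_mul (Real.exp_pos _).le,
      ← Real.exp_add]
    refine ENNReal.ofReal_le_ofReal (Real.exp_le_exp.2 ?_)
    have := mul_le_mul_of_nonneg_left hp' (show 0 ≤ 2 * (a - 1) by linarith)
    linarith
  have hN : ∀ a : ℝ, 1 ≤ a → ENNReal.ofReal (Real.exp (-(2 * a * (s + δ / 2)))) * m ≤
      ∫⁻ p, ‖expProfile a (hypPt s p)‖ₑ ^ 2 := fun a ha => by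
    rw [hm, ← setLIntegral_const]
    refine le_trans (setLIntegral_mono' hSm fun p hp => ?_) (setLIntegral_le_lintegral S _)
    have hp' : (hypPt s p).snd ≤ s + δ / 2 := le_of_lt hp
    rw [enorm_expProfile_sq]
    refine ENNReal.ofReal_le_ofReal (Real.exp_le_exp.2 ?_)
    have := mul_le_mul_of_nonneg_left hp' (show 0 ≤ 2 * a by linarith)
    linarith
  have hlim : Tendsto (fun a : ℝ => ENNReal.ofReal (Real.exp (-(a * δ))) *
      (ENNReal.ofReal (Real.exp (2 * (s + δ))) * N₁)) atTop (𝓝 0) := by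
    have h1 : Tendsto (fun a : ℝ => Real.exp (-(a * δ))) atTop (𝓝 0) :=
      Real.tendsto_exp_neg_atTop_nhds_zero.comp (tendsto_id.atTop_mul_const hδ)
    have h2 := ENNReal.tendsto_ofReal h1
    rw [ENNReal.ofReal_zero] at h2
    have h3 := ENNReal.Tendsto.mul_const h2 (b := ENNReal.ofReal (Real.exp (2 * (s + δ))) * N₁)
      (Or.inr (ENNReal.mul_ne_top ENNReal.ofReal_ne_top hN₁'))
    rwa [zero_mul] at h3
  have hpos : 0 < ε * m := pos_iff_ne_zero.2 (mul_ne_zero hε hm0)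
  obtain ⟨a, ha, ha1⟩ := ((hlim.eventually_lt_const hpos).and (eventually_ge_atTop 1)).exists
  refine ⟨a, by linarith, (hT a ha1).trans ?_⟩
  calc ENNReal.ofReal (Real.exp (-(2 * (a - 1) * (s + δ)))) * N₁
      = ENNReal.ofReal (Real.exp (-(2 * a * (s + δ / 2)))) *
        (ENNReal.ofReal (Real.exp (-(a * δ))) *
          (ENNReal.ofReal (Real.exp (2 * (s + δ))) * N₁)) := by
        rw [← mul_assoc, ← mul_assoc, ← ENNReal.ofReal_mul (Real.exp_pos _).le, ← Real.exp_add,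
          ← ENNReal.ofReal_mul (Real.exp_pos _).le, ← Real.exp_add]
        congr 3
        ring
    _ ≤ ENNReal.ofReal (Real.exp (-(2 * a * (s + δ / 2)))) * (ε * m) := by gcongr
    _ = ε * (ENNReal.ofReal (Real.exp (-(2 * a * (s + δ / 2)))) * m) := by ring
    _ ≤ _ := by gcongr; exact hN a ha1

/-- Exponentials satisfy $f(x)f(y)=f(x+y)$, so the quartic identity holds for them. At least a
fraction $1-\delta$ of the mass lies below height $s+\delta$, where the kernel is at least
$1/(2(s+\delta))$; then $\delta\to0$. -/
theorem mul_le_bestConstant_pow_four {s : ℝ} (hs : 0 < s) {C : ℝ≥0∞} (hC : C ≠ ∞)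
    (heq : ∀ h : ℝ × ℝ → ℂ, Measurable h → Integrable h → MemLp h 2 →
      (∃ H : SpaceTime 2 → ℂ, Measurable H ∧ ∀ y, h y.1 * h y.2 = H (pairSum s y)) →
      ∫⁻ x, ‖extFn s h x‖ₑ ^ 4 = C * pairEnergy s h) :
    C * ENNReal.ofReal (1 / (2 * s)) ≤ bestConstant 2 s 4 ^ 4 := by
  have key : ∀ δ : ℝ, 0 < δ → δ < 1 →
      C * ENNReal.ofReal (1 / (2 * (s + δ)) * (1 - δ) ^ 2) ≤ bestConstant 2 s 4 ^ 4 := by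
    intro δ hδ hδ1
    obtain ⟨a, ha, htail⟩ := exists_tail_expProfile_le hs hδ
      (ε := ENNReal.ofReal δ) (by simpa using hδ)
    obtain ⟨hi, h2⟩ := integrable_and_memLp_expProfile hs ha
    have hm : Measurable (expProfile a ∘ hypPt s) :=
      ((continuous_expProfile a).comp (continuous_hypPt s)).measurable
    set N := ∫⁻ p, ‖expProfile a (hypPt s p)‖ₑ ^ 2 with hN
    have hNtop : N ≠ ∞ := (lintegral_enorm_sq_lt_top h2).ne
    have hN0 : N ≠ 0 := by
      rw [hN, ne_eq, lintegral_eq_zero_iff (by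
        have := hm.enorm.pow_const 2
        exact this)]
      intro h0
      have h1 : ∀ p, ‖expProfile a (hypPt s p)‖ₑ ^ 2 ≠ 0 := fun p => by
        rw [enorm_expProfile_sq]
        simpa using Real.exp_pos _
      have h3 : ∀ᵐ _ : ℝ × ℝ, False := h0.mono fun p hp => h1 p hp
      have : (volume : Measure (ℝ × ℝ)).IsAddHaarMeasure := Measure.prod.instIsAddHaarMeasure _ _
      exact h3.exists.elim fun _ h => h
    have hH : ∀ y : (ℝ × ℝ) × (ℝ × ℝ), expProfile a (hypPt s y.1) * expProfile a (hypPt s y.2) =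
        expProfile a (pairSum s y) := fun y => by
      simp only [expProfile, pairSum, ← Complex.ofReal_mul, ← Real.exp_add, WithLp.add_snd]
      congr 2
      ring
    have h3 := le_bestConstant_pow_four hs hC heq hm hi h2 hN0
      (continuous_expProfile a).measurable hH
    rw [← hN] at h3
    have h4 := le_pairEnergy_of_snd_lt (b := s + δ) hs hm
    set M := ∫⁻ p in {p | (hypPt s p).snd < s + δ}, ‖(expProfile a ∘ hypPt s) p‖ₑ ^ 2 with hM
    have h5 : ENNReal.ofReal (1 - δ) * N ≤ M := by
      have h6 : N = M + ∫⁻ p in {p | (hypPt s p).snd < s + δ}ᶜ,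
          ‖expProfile a (hypPt s p)‖ₑ ^ 2 :=
        (lintegral_add_compl _ (measurableSet_snd_lt s _)).symm
      rw [ENNReal.ofReal_sub _ hδ.le, ENNReal.ofReal_one, ENNReal.sub_mul (fun _ _ => hNtop),
        one_mul, tsub_le_iff_right]
      calc N = _ := h6
        _ ≤ _ := by gcongr
    have h7 : C * ENNReal.ofReal (1 / (2 * (s + δ)) * (1 - δ) ^ 2) * N ^ 2 ≤
        bestConstant 2 s 4 ^ 4 * N ^ 2 := by
      calc _ = C * (ENNReal.ofReal (1 / (2 * (s + δ))) * (ENNReal.ofReal (1 - δ) * N) ^ 2) := by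
            rw [ENNReal.ofReal_mul (by positivity), ENNReal.ofReal_pow (by linarith)]
            ring
        _ ≤ C * (ENNReal.ofReal (1 / (2 * (s + δ))) * M ^ 2) := by gcongr
        _ ≤ C * pairEnergy s (expProfile a ∘ hypPt s) := by gcongr
        _ ≤ _ := h3
    exact (ENNReal.mul_le_mul_iff_left (pow_ne_zero 2 hN0) (ENNReal.pow_ne_top hNtop)).1 h7
  have hcont : Tendsto (fun δ : ℝ => 1 / (2 * (s + δ)) * (1 - δ) ^ 2) (𝓝[>] 0)
      (𝓝 (1 / (2 * (s + 0)) * (1 - 0) ^ 2)) := by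
    refine Tendsto.mono_left (ContinuousAt.tendsto ?_) nhdsWithin_le_nhds
    have : 2 * (s + 0) ≠ 0 := by positivity
    fun_prop (disch := assumption)
  have hlim := ENNReal.Tendsto.const_mul (ENNReal.tendsto_ofReal hcont) (Or.inr hC)
  simp only [add_zero, sub_zero, one_pow, mul_one] at hlim
  refine le_of_tendsto hlim ?_
  filter_upwards [Ioo_mem_nhdsGT one_pos] with δ hδ
  exact key δ hδ.1 hδ.2

/-! ### Lorentz transformations and concentration at the vertex -/

/-- In light-cone coordinates, the composition of a boost and a null rotation. -/
noncomputable def coneShear (l c : ℝ) (hl : l ≠ 0) : (ℝ × ℝ × ℝ) ≃ₗ[ℝ] ℝ × ℝ × ℝ where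
  toFun x := (l * x.1, x.2.1 + c * x.1, (x.2.2 + 2 * c * x.2.1 + c ^ 2 * x.1) / l)
  map_add' x y := by
    refine Prod.ext ?_ (Prod.ext ?_ ?_) <;> simp <;> ring
  map_smul' r x := by
    refine Prod.ext ?_ (Prod.ext ?_ ?_) <;> simp <;> ring
  invFun x := (x.1 / l, x.2.1 - c * (x.1 / l),
    l * x.2.2 - 2 * c * (x.2.1 - c * (x.1 / l)) - c ^ 2 * (x.1 / l))
  left_inv x := by
    refine Prod.ext ?_ (Prod.ext ?_ ?_) <;> simp only <;> field_simp <;> ring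
  right_inv x := by
    refine Prod.ext ?_ (Prod.ext ?_ ?_) <;> simp only <;> field_simp <;> ring

theorem coneShear_apply (l c : ℝ) (hl : l ≠ 0) (x : ℝ × ℝ × ℝ) : coneShear l c hl x =
    (l * x.1, x.2.1 + c * x.1, (x.2.2 + 2 * c * x.2.1 + c ^ 2 * x.1) / l) := rfl

theorem coneSq_coneShear (l c : ℝ) (hl : l ≠ 0) (x : ℝ × ℝ × ℝ) :
    coneSq (coneShear l c hl x) = coneSq x := by
  rw [coneShear_apply, coneSq, coneSq]
  field_simp
  ring

/-- The Lorentz transformation that is `coneShear` in light-cone coordinates. -/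
noncomputable def lorentzShear (l c : ℝ) (hl : l ≠ 0) : SpaceTime 2 ≃ₗ[ℝ] SpaceTime 2 :=
  (coneCoordLinear.trans (coneShear l c hl)).trans coneCoordLinear.symm

theorem coneCoord_lorentzShear (l c : ℝ) (hl : l ≠ 0) (z : SpaceTime 2) :
    coneCoord (lorentzShear l c hl z) = coneShear l c hl (coneCoord z) :=
  coneCoordLinear.apply_symm_apply _

theorem lorentzForm_eq (x y : SpaceTime 2) : lorentzForm 2 x y =
    ((coneCoord x).1 * (coneCoord y).2.2 + (coneCoord x).2.2 * (coneCoord y).1) / 2 -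
      (coneCoord x).2.1 * (coneCoord y).2.1 := by
  rw [lorentzForm, coneCoord_apply, coneCoord_apply]
  simp only [PiLp.inner_apply, Fin.sum_univ_two, RCLike.inner_apply, conj_trivial]
  ring

theorem mem_hyperboloid_iff {s : ℝ} (hs : 0 < s) (z : SpaceTime 2) :
    z ∈ hyperboloid 2 s ↔ 0 < (coneCoord z).1 ∧ coneSq (coneCoord z) = s ^ 2 := by
  have h1 : z ∈ hyperboloid 2 s ↔ z.snd = √(s ^ 2 + (z.fst 0 ^ 2 + z.fst 1 ^ 2)) := by
    rw [← norm_sq_euclidean_two]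
    rfl
  rw [h1, coneCoord_apply, coneSq]
  simp only
  constructor
  · intro h
    have h2 : z.snd ^ 2 = s ^ 2 + (z.fst 0 ^ 2 + z.fst 1 ^ 2) := by
      rw [h]
      exact Real.sq_sqrt (by positivity)
    have h3 : 0 ≤ z.snd := h ▸ Real.sqrt_nonneg _
    refine ⟨?_, by linear_combination h2⟩
    have h4 : |z.fst 0| < |z.snd| := by
      rw [← sq_lt_sq, h2]
      nlinarith [sq_nonneg (z.fst 1), pow_pos hs 2]
    rw [abs_of_nonneg h3] at h4
    linarith [neg_abs_le (z.fst 0)]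
  · rintro ⟨h2, h3⟩
    have h4 : 0 < (z.snd + z.fst 0) * (z.snd - z.fst 0) := by
      nlinarith [sq_nonneg (z.fst 1), pow_pos hs 2]
    have h5 : 0 < z.snd - z.fst 0 := pos_of_mul_pos_right h4 h2.le
    rw [eq_comm, Real.sqrt_eq_iff_mul_self_eq (by positivity) (by linarith)]
    linear_combination -h3

theorem lorentzShear_mem {s : ℝ} (hs : 0 < s) {l : ℝ} (c : ℝ) (hl : 0 < l) :
    lorentzShear l c hl.ne' ∈ lorentzGroupPlus 2 s := by
  refine ⟨fun x y => ?_, fun z => ?_⟩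
  · rw [lorentzForm_eq, lorentzForm_eq, coneCoord_lorentzShear, coneCoord_lorentzShear,
      coneShear_apply, coneShear_apply]
    field_simp
    ring
  · rw [mem_hyperboloid_iff hs, mem_hyperboloid_iff hs, coneCoord_lorentzShear, coneSq_coneShear,
      coneShear_apply]
    simp only [mul_pos_iff_of_pos_left hl]

/-- The action of `lorentzShear` in the coordinates of the hyperboloid. -/
noncomputable def paramShear (a c : ℝ) (p : ℝ × ℝ) : ℝ × ℝ := (p.1 + a, p.2 + c * Real.exp p.1)

theorem conePt_paramShear (s a c : ℝ) (p : ℝ × ℝ) : conePt s (paramShear a c p) =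
    coneShear (Real.exp a) c (Real.exp_pos a).ne' (conePt s p) := by
  rw [coneShear_apply]
  simp only [conePt, paramShear, neg_add, Real.exp_add, Real.exp_neg]
  refine Prod.ext ?_ (Prod.ext ?_ ?_)
  · ring
  · rfl
  · field_simp
    ring

theorem lorentzShear_hypPt (s a c : ℝ) (p : ℝ × ℝ) :
    lorentzShear (Real.exp a) c (Real.exp_pos a).ne' (hypPt s p) = hypPt s (paramShear a c p) := by
  apply coneCoord.injective
  rw [coneCoord_lorentzShear, coneCoord_hypPt, coneCoord_hypPt, conePt_paramShear]

theorem pairKernel_paramShear (s a c : ℝ) (p p' : ℝ × ℝ) :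
    pairKernel s (paramShear a c p, paramShear a c p') = pairKernel s (p, p') := by
  rw [pairKernel, pairKernel, conePt_paramShear, conePt_paramShear, ← map_add, coneSq_coneShear]

theorem continuous_paramShear (a c : ℝ) : Continuous (paramShear a c) := by
  unfold paramShear
  fun_prop

theorem measurableEmbedding_paramShear (a c : ℝ) : MeasurableEmbedding (paramShear a c) := by
  refine (continuous_paramShear a c).measurableEmbedding fun p q h => ?_
  have h1 : p.1 = q.1 := add_right_cancel (congrArg Prod.fst h)
  have h2 := congrArg Prod.snd h
  simp only [paramShear, h1] at h2
  exact Prod.ext h1 (add_right_cancel h2)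

/-- A translation in $v$ for each fixed $t$, followed by a translation in $t$. This is the Lorentz
invariance of $\sigma_s$. -/
theorem measurePreserving_paramShear (a c : ℝ) :
    MeasurePreserving (paramShear a c) volume volume := by
  have hm := (continuous_paramShear a c).measurable
  refine ⟨hm, Measure.ext_of_lintegral _ fun F hF => ?_⟩
  rw [lintegral_map hF hm, Measure.volume_eq_prod,
    lintegral_prod (fun p => F (paramShear a c p)) (hF.comp hm).aemeasurable,
    lintegral_prod F hF.aemeasurable]
  simp only [paramShear]
  have h1 : ∀ t, ∫⁻ v, F (t + a, v + c * Real.exp t) = ∫⁻ v, F (t + a, v) := fun t =>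
    lintegral_add_right_eq_self (fun v => F (t + a, v)) _
  simp_rw [h1]
  exact lintegral_add_right_eq_self (fun t => ∫⁻ v, F (t, v)) a

/-- The average of the defect over $x$ with weight $|h(x)|^2$ cannot be below its minimum, and the
total defect is $\kappa\|h\|_2^4-E\le\kappa-E$. Multiplying by $E\le\kappa\|h\|_2^4$ removes the
division by $\|h\|_2^2$. -/
theorem exists_center {s : ℝ} (hs : 0 < s) {h : ℝ × ℝ → ℂ} (hm : Measurable h)
    (h1 : ∫⁻ p, ‖h p‖ₑ ^ 2 ≤ 1) : ∃ x : ℝ × ℝ,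
      (∫⁻ q, (ENNReal.ofReal (1 / (2 * s)) - pairKernel s (x, q)) * ‖h q‖ₑ ^ 2) *
        pairEnergy s h ≤
      ENNReal.ofReal (1 / (2 * s)) * (ENNReal.ofReal (1 / (2 * s)) - pairEnergy s h) := by
  set κ := ENNReal.ofReal (1 / (2 * s)) with hκ
  have hκ' : κ ≠ ∞ := ENNReal.ofReal_ne_top
  set N := ∫⁻ p, ‖h p‖ₑ ^ 2 with hN
  have hK := measurable_pairKernel s
  have hE : pairEnergy s h ≤ κ * N ^ 2 := by
    have := pairEnergy_le hs hm
    rwa [show eLpNorm h 2 volume ^ 4 = (eLpNorm h 2 volume ^ 2) ^ 2 by ring,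
      eLpNorm_two_pow] at this
  have hNtop : N ≠ ∞ := (h1.trans_lt ENNReal.one_lt_top).ne
  by_cases hN0 : N = 0
  -- For $h=0$ there is no average, but the energy vanishes and any centre works.
  · refine ⟨0, ?_⟩
    have : pairEnergy s h = 0 := by simpa [hN0] using hE
    simp [this]
  set A : ℝ × ℝ → ℝ≥0∞ := fun x => ∫⁻ q, (κ - pairKernel s (x, q)) * ‖h q‖ₑ ^ 2 with hA
  have hint : Measurable fun y : (ℝ × ℝ) × (ℝ × ℝ) =>
      (κ - pairKernel s y) * ‖h y.2‖ₑ ^ 2 := by fun_prop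
  have hint' : Measurable fun y : (ℝ × ℝ) × (ℝ × ℝ) =>
      ‖h y.1‖ₑ ^ 2 * ((κ - pairKernel s y) * ‖h y.2‖ₑ ^ 2) := by fun_prop
  have hAm : Measurable A := hint.lintegral_prod_right'
  set μ : Measure (ℝ × ℝ) := volume.withDensity fun p => ‖h p‖ₑ ^ 2 with hμ
  have hμ1 : μ Set.univ = N := by rw [hμ, withDensity_apply _ MeasurableSet.univ]; simp [hN]
  have hμ0 : μ ≠ 0 := by
    intro h0
    rw [h0] at hμ1
    exact hN0 hμ1.symm
  have : IsFiniteMeasure μ := ⟨by rw [hμ1]; exact hNtop.lt_top⟩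
  obtain ⟨x, hx⟩ := exists_le_laverage hμ0 hAm.aemeasurable
  have hEtop : pairEnergy s h ≠ ∞ :=
    (hE.trans_lt (ENNReal.mul_lt_top hκ'.lt_top (ENNReal.pow_lt_top hNtop.lt_top))).ne
  have hAint : ∫⁻ p, A p ∂μ ≤ κ - pairEnergy s h := by
    refine ENNReal.le_sub_of_add_le_right hEtop ?_
    have e1 : ∫⁻ p, A p ∂μ = ∫⁻ y : (ℝ × ℝ) × (ℝ × ℝ),
        ‖h y.1‖ₑ ^ 2 * ((κ - pairKernel s y) * ‖h y.2‖ₑ ^ 2) := by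
      rw [hμ, lintegral_withDensity_eq_lintegral_mul _ (by fun_prop) hAm,
        Measure.volume_eq_prod (ℝ × ℝ) (ℝ × ℝ), lintegral_prod]
      · refine lintegral_congr fun p => ?_
        simp only [Pi.mul_apply, hA]
        rw [lintegral_const_mul _ (show Measurable fun q => (κ - pairKernel s (p, q)) * ‖h q‖ₑ ^ 2
          from hint.comp measurable_prodMk_left)]
      · exact hint'.aemeasurable
    rw [e1, pairEnergy, ← lintegral_add_left hint']
    calc _ = ∫⁻ y : (ℝ × ℝ) × (ℝ × ℝ), κ * ‖h y.1 * h y.2‖ₑ ^ 2 := by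
          refine lintegral_congr fun y => ?_
          have : κ - pairKernel s y + pairKernel s y = κ := tsub_add_cancel_of_le (pairKernel_le hs y)
          rw [enorm_mul, mul_pow]
          calc _ = (κ - pairKernel s y + pairKernel s y) * (‖h y.1‖ₑ ^ 2 * ‖h y.2‖ₑ ^ 2) := by ring
            _ = _ := by rw [this]
      _ = κ * N ^ 2 := by rw [lintegral_const_mul _ (by fun_prop), lintegral_enorm_sq_mul hm]
      _ ≤ κ * 1 ^ 2 := by gcongr
      _ = κ := by simp
  refine ⟨x, ?_⟩
  rw [laverage_eq, hμ1] at hx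
  have hx2 : A x * N ≤ κ - pairEnergy s h := by
    rw [ENNReal.le_div_iff_mul_le (Or.inl hN0) (Or.inl hNtop)] at hx
    exact hx.trans hAint
  calc A x * pairEnergy s h ≤ A x * (κ * N ^ 2) := by gcongr
    _ = κ * (A x * N) * N := by ring
    _ ≤ κ * (κ - pairEnergy s h) * 1 := by gcongr
    _ = _ := mul_one _

/-- The Lorentz square of $P+z$ is $2s^2+2s\tau$, so the kernel at the vertex drops strictly once
$\tau$ exceeds $s$ by a fixed amount. -/
theorem exists_pairKernel_gap {s r : ℝ} (hs : 0 < s) (hr : 0 < r) : ∃ δ : ℝ≥0∞, δ ≠ 0 ∧ δ ≠ ∞ ∧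
    ∀ p, r < ‖hypPt s p - vertex 2 s‖ →
      δ ≤ ENNReal.ofReal (1 / (2 * s)) - pairKernel s ((Real.log s, 0), p) := by
  -- On the hyperboloid $|z-P|^2=2\tau(\tau-s)$. If $\tau<s+\eta$, then $\tau<2s$ and this is less
  -- than $4s\cdot r^2/(4s)=r^2$.
  set η := min s (r ^ 2 / (4 * s)) with hη
  have hη0 : 0 < η := lt_min hs (by positivity)
  have hsq : 2 * s < √(4 * s ^ 2 + 2 * s * η) := by
    rw [Real.lt_sqrt (by positivity)]
    nlinarith [mul_pos hs hη0]
  refine ⟨ENNReal.ofReal (1 / (2 * s) - 1 / √(4 * s ^ 2 + 2 * s * η)), ?_, ENNReal.ofReal_ne_top,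
    fun p hp => ?_⟩
  · simp only [ne_eq, ENNReal.ofReal_eq_zero, not_le, sub_pos]
    exact one_div_lt_one_div_of_lt (by positivity) hsq
  · have hnorm : ‖hypPt s p - vertex 2 s‖ ^ 2 =
        ‖(hypPt s p).fst‖ ^ 2 + ((hypPt s p).snd - s) ^ 2 := by
      rw [WithLp.prod_norm_sq_eq_of_L2]
      simp [vertex]
    have h1 := hypPt_snd_sq s p
    have h2 : r ^ 2 < ‖hypPt s p - vertex 2 s‖ ^ 2 := by gcongr
    have h3 := le_hypPt_snd hs p
    have h4 : s + η ≤ (hypPt s p).snd := by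
      by_contra! h5
      have h6 : (hypPt s p).snd < 2 * s := by linarith [min_le_left s (r ^ 2 / (4 * s))]
      have h7 : (hypPt s p).snd - s < r ^ 2 / (4 * s) := by
        linarith [min_le_right s (r ^ 2 / (4 * s))]
      rw [lt_div_iff₀ (by positivity)] at h7
      nlinarith
    have h8 : coneSq (conePt s (Real.log s, 0) + conePt s p) =
        2 * s ^ 2 + 2 * s * (hypPt s p).snd := by
      have hE : Real.exp p.1 * Real.exp (-p.1) = 1 := by rw [← Real.exp_add]; simp
      simp only [coneSq, conePt, hypPt_snd, Prod.fst_add, Prod.snd_add, Real.exp_neg (Real.log s),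
        Real.exp_log hs]
      field_simp
      linear_combination s * (s ^ 2 + p.2 ^ 2) * hE
    rw [ENNReal.ofReal_sub _ (by positivity)]
    refine tsub_le_tsub_left (ENNReal.ofReal_le_ofReal ?_) _
    rw [h8]
    refine one_div_le_one_div_of_le (lt_trans (by positivity) hsq) (Real.sqrt_le_sqrt ?_)
    nlinarith

/-- The change of variables by the Lorentz map preserves $\sigma_s$ and the kernel, so distance from
the vertex turns into a kernel defect relative to the image of the vertex. -/
theorem lintegral_pullback_lorentzShear_le {s r : ℝ} (hs : 0 < s) {δ : ℝ≥0∞}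
    (hδ : ∀ p, r < ‖hypPt s p - vertex 2 s‖ →
      δ ≤ ENNReal.ofReal (1 / (2 * s)) - pairKernel s ((Real.log s, 0), p))
    (f : SpaceTime 2 → ℂ) (a c : ℝ) :
    ∫⁻ z in {z | r < ‖z - vertex 2 s‖},
      ‖pullback 2 (lorentzShear (Real.exp a) c (Real.exp_pos a).ne') f z‖ₑ ^ 2 ∂(sigma 2 s) ≤
    ∫⁻ q in {q | δ ≤ ENNReal.ofReal (1 / (2 * s)) -
      pairKernel s (paramShear a c (Real.log s, 0), q)}, ‖f (hypPt s q)‖ₑ ^ 2 := by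
  have hemb := measurableEmbedding_hypPt s
  rw [sigma_eq_map hs, hemb.restrict_map, hemb.lintegral_map]
  simp only [pullback, lorentzShear_hypPt]
  rw [← (measurePreserving_paramShear a c).setLIntegral_comp_preimage_emb
    (measurableEmbedding_paramShear a c) (fun q => ‖f (hypPt s q)‖ₑ ^ 2)
    {q | δ ≤ ENNReal.ofReal (1 / (2 * s)) - pairKernel s (paramShear a c (Real.log s, 0), q)}]
  refine lintegral_mono_set fun p hp => ?_
  simp only [Set.mem_preimage, Set.mem_ofPred_eq, pairKernel_paramShear]
  exact hδ p hp

/-- Extremizing sequences concentrate at the vertex after Lorentz transformations. -/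
theorem exists_lorentz_concentration (s : ℝ) (hs : 0 < s)
    (f : ℕ → SpaceTime 2 → ℂ)
    (hf : IsExtremizingSequence 2 s 4 f) :
    ∃ L : ℕ → SpaceTime 2 ≃ₗ[ℝ] SpaceTime 2,
      (∀ n, L n ∈ lorentzGroupPlus 2 s) ∧
      ∀ ε : ℝ, 0 < ε → ∀ r : ℝ, 0 < r → ∃ N : ℕ, ∀ n : ℕ, N ≤ n →
        ∫⁻ z in {z | r < ‖z - vertex 2 s‖},
          ‖pullback 2 (L n) (f n) z‖ₑ ^ 2
            ∂(sigma 2 s) ≤ ENNReal.ofReal ε := by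
  obtain ⟨C, hC0, hC, hle, heq⟩ := exists_lintegral_extFn_pow_four hs
  set κ := ENNReal.ofReal (1 / (2 * s)) with hκ
  have hκ0 : κ ≠ 0 := by simpa [hκ] using hs
  have hκtop : κ ≠ ∞ := ENNReal.ofReal_ne_top
  have h2 : ∀ n, MemLp (f n ∘ hypPt s) 2 volume := fun n => (memLp_sigma_iff hs _ _).1 (hf.memLp n)
  have hmk : ∀ n, ∃ h : ℝ × ℝ → ℂ, Measurable h ∧ f n ∘ hypPt s =ᵐ[volume] h := fun n =>
    ⟨_, (h2 n).aestronglyMeasurable.stronglyMeasurable_mk.measurable,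
      (h2 n).aestronglyMeasurable.ae_eq_mk⟩
  choose h hm hae using hmk
  have h1 : ∀ n, ∫⁻ p, ‖h n p‖ₑ ^ 2 ≤ 1 := fun n => by
    rw [← eLpNorm_two_pow, ← eLpNorm_congr_ae (hae n), ← eLpNorm_sigma hs]
    exact pow_le_one' (hf.norm_le_one n) 2
  choose x hx using fun n => exists_center hs (hm n) (h1 n)
  -- $C\kappa\le\mathbf H^4=\lim\|T_sf_n\|_4^4$ and $\|T_sf_n\|_4^4\le CE_n$; the constant `C`
  -- cancels.
  have hEnergy : ∀ κ' < κ, ∀ᶠ n in atTop, κ' < pairEnergy s (h n) := fun κ' hκ' => by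
    have l1 : Tendsto (fun n => extensionNorm 2 s 4 (f n) ^ 4) atTop (𝓝 (bestConstant 2 s 4 ^ 4)) :=
      ((ENNReal.continuous_pow 4).tendsto _).comp hf.tendsto
    have l2 : C * κ' < bestConstant 2 s 4 ^ 4 :=
      ((ENNReal.mul_lt_mul_iff_right hC0 hC).2 hκ').trans_le
        (mul_le_bestConstant_pow_four hs hC heq)
    filter_upwards [l1.eventually_const_lt l2] with n hn
    have l3 := hn.trans_le (extensionNorm_pow_four_le hs hC hle (hf.memLp n))
    rw [pairEnergy_congr_ae (hae n)] at l3
    exact (ENNReal.mul_lt_mul_iff_right hC0 hC).1 l3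
  -- The boost and null rotation are chosen so that the vertex, with parameters $(\log s,0)$, goes
  -- to the centre `x n`; the factor $e^{\log s}=s$ explains the division by `s`.
  refine ⟨fun n => lorentzShear (Real.exp ((x n).1 - Real.log s)) ((x n).2 / s)
    (Real.exp_pos _).ne', fun n => lorentzShear_mem hs _ (Real.exp_pos _), fun ε hε r hr => ?_⟩
  obtain ⟨δ, hδ0, hδtop, hδ⟩ := exists_pairKernel_gap hs hr
  have hε0 : ENNReal.ofReal ε ≠ 0 := by simpa using hε
  -- With $E_n>\kappa/2$ and $\kappa-E_n\le\theta$, the centre inequality gives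
  -- $A\le2\theta=\delta\varepsilon$.
  set θ := δ * ENNReal.ofReal ε / 2 with hθ
  have hθ0 : θ ≠ 0 := (ENNReal.div_pos (mul_ne_zero hδ0 hε0) (by simp)).ne'
  have hev := (hEnergy (κ / 2) (ENNReal.half_lt_self hκ0 hκtop)).and
    (hEnergy (κ - θ) (ENNReal.sub_lt_self hκtop hκ0 hθ0))
  obtain ⟨N, hN⟩ := eventually_atTop.1 hev
  refine ⟨N, fun n hn => ?_⟩
  obtain ⟨hE1, hE2⟩ := hN n hn
  have hcenter : paramShear ((x n).1 - Real.log s) ((x n).2 / s) (Real.log s, 0) = x n := by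
    simp only [paramShear, Real.exp_log hs]
    refine Prod.ext (by simp) ?_
    simp only
    field_simp
    ring
  refine (lintegral_pullback_lorentzShear_le hs hδ (f n) _ _).trans ?_
  rw [hcenter]
  set A := ∫⁻ q, (κ - pairKernel s (x n, q)) * ‖h n q‖ₑ ^ 2 with hA
  have hA2 : A ≤ δ * ENNReal.ofReal ε := by
    have e1 : κ - pairEnergy s (h n) ≤ θ := by
      rw [tsub_le_iff_left]
      have := tsub_le_iff_right.1 hE2.le
      exact this
    have e2 : A * (κ / 2) ≤ κ * θ :=
      calc A * (κ / 2) ≤ A * pairEnergy s (h n) := by gcongr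
        _ ≤ κ * (κ - pairEnergy s (h n)) := hx n
        _ ≤ κ * θ := by gcongr
    have e3 : κ / 2 * A ≤ κ / 2 * (δ * ENNReal.ofReal ε) := by
      calc κ / 2 * A = A * (κ / 2) := mul_comm _ _
        _ ≤ κ * θ := e2
        _ = _ := by rw [hθ, div_eq_mul_inv, div_eq_mul_inv]; ring
    exact (ENNReal.mul_le_mul_iff_right (ENNReal.div_pos hκ0 (by simp)).ne'
      (ENNReal.div_ne_top hκtop (by simp))).1 e3
  have hS : MeasurableSet {q | δ ≤ κ - pairKernel s (x n, q)} := by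
    have := measurable_pairKernel s
    exact measurableSet_le measurable_const (by fun_prop)
  -- Chebyshev's inequality for the kernel defect.
  have hM : δ * ∫⁻ q in {q | δ ≤ κ - pairKernel s (x n, q)}, ‖f n (hypPt s q)‖ₑ ^ 2 ≤ A := by
    rw [← lintegral_const_mul' _ _ hδtop, hA]
    calc _ = ∫⁻ q in {q | δ ≤ κ - pairKernel s (x n, q)}, δ * ‖h n q‖ₑ ^ 2 := by
          refine lintegral_congr_ae (ae_restrict_of_ae ?_)
          filter_upwards [hae n] with q hq
          rw [← hq]
          rfl
      _ ≤ ∫⁻ q in {q | δ ≤ κ - pairKernel s (x n, q)},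
            (κ - pairKernel s (x n, q)) * ‖h n q‖ₑ ^ 2 := by
          refine setLIntegral_mono' hS fun q hq => ?_
          gcongr
          exact hq
      _ ≤ _ := setLIntegral_le_lintegral _ _
  exact (ENNReal.mul_le_mul_iff_right hδ0 hδtop).1 (hM.trans hA2)

end HyperboloidRestriction

theorem mainTheorem5 (s : ℝ) (hs : 0 < s)
    (f : ℕ → HyperboloidRestriction.SpaceTime 2 → ℂ)
    (hf : HyperboloidRestriction.IsExtremizingSequence 2 s 4 f) :
    ∃ L : ℕ → HyperboloidRestriction.SpaceTime 2 ≃ₗ[ℝ] HyperboloidRestriction.SpaceTime 2,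
      (∀ n, L n ∈ HyperboloidRestriction.lorentzGroupPlus 2 s) ∧
      ∀ ε : ℝ, 0 < ε → ∀ r : ℝ, 0 < r → ∃ N : ℕ, ∀ n : ℕ, N ≤ n →
        ∫⁻ z in {z | r < ‖z - HyperboloidRestriction.vertex 2 s‖},
          ‖HyperboloidRestriction.pullback 2 (L n) (f n) z‖ₑ ^ 2
            ∂(HyperboloidRestriction.sigma 2 s) ≤ ENNReal.ofReal ε :=
  HyperboloidRestriction.exists_lorentz_concentration s hs f hf
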